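/- Let $G=(V,E)$ be a finite simple $d$-regular graph, $d\ge 1$, with $n=|V|$ vertices. For $S\subseteq C\subseteq V$ with $S\neq\emptyset$ let $\phi^G_C(S)=\frac{|E(S,C\setminus S)|}{d|S|}$. The external conductance of a nonempty $C\subseteq V$ is $\phi^G_V(C)$; its internal conductance $\phi^G(C)$ is $\min\{\phi^G_C(S): S\subseteq C,\ 0<|S|\le |C|/2\}$ if $|C|>1$, and $1$ otherwise. For $R\ge 1$, a $(k,\varphi,\epsilon)$-clustering of $G$ with size ratio at most $R$ is a partition of $V$ into nonempty sets $C_1,\dots,C_k$ such that $\phi^G(C_i)\ge\varphi$, $\phi^G_V(C_i)\le\epsilon$ and $|C_i|/|C_j|\le R$ for all $i,j$. Let $L=I-\frac1d A_G$ be the normalized Laplacian, where $A_G$ is the adjacency matrix, and let $u_1,\dots,u_n$ be any orthonormal basis of eigenvectors of $L$, ordered by nondecreasing eigenvalue. For $k\le n$ the corresponding spectral embedding is $f_x=(u_1(x),\dots,u_k(x))\in\mathbb{R}^k$, $x\in V$. **Lemma.** There is an absolute constant $c_0>0$, and for every $R\ge 1$ there is a constant $c>0$ depending only on $R$, such that the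 following holds. Let $\zeta,\delta,\varphi\in(0,1)$, let $k\ge 2$ be an integer, and let $\epsilon\ge 0$ satisfy $\frac{\epsilon\log k}{\varphi^2}\le c_0$. Let $G$ be a $d$-regular graph that admits a $(k,\varphi,\epsilon)$-clustering $C_1,\dots,C_k$ with size ratio at most $R$, let $(f_x)_{x\in V}$ be any spectral embedding of $G$ into $\mathbb{R}^k$, and let $C$ be one of the clusters $C_1,\dots,C_k$. Let $s$ be an integer with $$s\ \ge\ c\cdot\left(k\cdot\log\left(\frac{k}{\delta}\right)\cdot\left(\frac1\delta\right)^{80\epsilon/\varphi^2}\cdot\left(\frac1\zeta\right)^2\right)^{1/(1-80\epsilon/\varphi^2)},$$ and let $x_1,\dots,x_s$ be independent, uniformly distributed random vertices of $C$. Put $\mu=\frac1{|C|}\sum_{x\in C}f_x$ and $\widehat\mu=\frac1s\sum_{i=1}^s f_{x_i}$. Then with probability at least $1-\delta$, $$\|\mu-\widehat\mu\|_2\le\zeta\cdot\|\mu\|_2 .$$ -/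

import Mathlib

open MeasureTheory ProbabilityTheory

namespace SpectralClustering

noncomputable section

/-- The conductance `|E(S, C \ S)| / (d |S|)` of a set `S ⊆ C` within `C`.  As `S` and `C \ S` are
disjoint, the ordered pairs in `G.interedges S (C \ S)` correspond bijectively to the edges with one
endpoint in `S` and the other one in `C \ S`. -/
def conductanceWithin {V : Type*} [DecidableEq V] (G : SimpleGraph V) [DecidableRel G.Adj]
    (d : ℕ) (C S : Finset V) : ℝ :=
  ((G.interedges S (C \ S)).card : ℝ) / ((d : ℝ) * (S.card : ℝ))

/-- The external conductance `|E(C, V \ C)| / (d |C|)` of `C`. -/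
def externalConductance {V : Type*} [Fintype V] [DecidableEq V] (G : SimpleGraph V)
    [DecidableRel G.Adj] (d : ℕ) (C : Finset V) : ℝ :=
  conductanceWithin G d Finset.univ C

/-- The sets `S ⊆ C` with `0 < |S| ≤ |C| / 2`. -/
def smallSubsets {V : Type*} (C : Finset V) : Finset (Finset V) :=
  C.powerset.filter fun S => 0 < S.card ∧ 2 * S.card ≤ C.card

theorem smallSubsets_nonempty {V : Type*} {C : Finset V} (h : 1 < C.card) :
    (smallSubsets C).Nonempty := by
  obtain ⟨x, hx⟩ := Finset.card_pos.mp (by omega : 0 < C.card)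
  refine ⟨{x}, ?_⟩
  simp only [smallSubsets, Finset.mem_filter, Finset.mem_powerset, Finset.singleton_subset_iff,
    Finset.card_singleton]
  exact ⟨hx, by omega, by omega⟩

/-- The internal conductance of `C`: the minimum of the conductance of `S` within `C` over all
`S ⊆ C` with `0 < |S| ≤ |C| / 2` if `|C| > 1`, and one otherwise. -/
def internalConductance {V : Type*} [DecidableEq V] (G : SimpleGraph V)
    [DecidableRel G.Adj] (d : ℕ) (C : Finset V) : ℝ :=
  if h : 1 < C.card then
    (smallSubsets C).inf' (smallSubsets_nonempty h) (conductanceWithin G d C)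
  else 1

/-- `C₁, …, C_k` is a `(k, φ, ε)`-clustering of the `d`-regular graph `G` whose ratios of cluster
sizes are bounded by `R`. -/
structure IsClustering {V : Type*} [Fintype V] [DecidableEq V] (G : SimpleGraph V)
    [DecidableRel G.Adj] (d k : ℕ) (φ ε R : ℝ) (C : Fin k → Finset V) : Prop where
  nonempty : ∀ i, (C i).Nonempty
  disjoint : ∀ i j, i ≠ j → Disjoint (C i) (C j)
  cover : ∀ x, ∃ i, x ∈ C i
  internal : ∀ i, φ ≤ internalConductance G d (C i)
  external : ∀ i, externalConductance G d (C i) ≤ ε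
  balanced : ∀ i j, ((C i).card : ℝ) / ((C j).card : ℝ) ≤ R

/-- The normalized Laplacian `L = I - A / d` of a `d`-regular graph. -/
def normalizedLaplacian {V : Type*} [DecidableEq V] (G : SimpleGraph V) [DecidableRel G.Adj]
    (d : ℕ) : Matrix V V ℝ :=
  1 - (d : ℝ)⁻¹ • G.adjMatrix ℝ

/-- `f : V → ℝᵏ` is a spectral embedding of `G`: for some orthonormal basis `u₁, …, u_n` of
eigenvectors of the normalized Laplacian, ordered by nondecreasing eigenvalue, the vector `f x` is
`(u₁(x), …, u_k(x))`. -/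
def IsSpectralEmbedding {V : Type*} [Fintype V] [DecidableEq V] (G : SimpleGraph V)
    [DecidableRel G.Adj] (d k : ℕ) (f : V → EuclideanSpace ℝ (Fin k)) : Prop :=
  ∃ (hk : k ≤ Fintype.card V)
    (u : OrthonormalBasis (Fin (Fintype.card V)) ℝ (EuclideanSpace ℝ V))
    (ev : Fin (Fintype.card V) → ℝ),
    Monotone ev ∧
    (∀ j, Matrix.toEuclideanLin (normalizedLaplacian G d) (u j) = ev j • u j) ∧
    ∀ (x : V) (i : Fin k), f x i = u (Fin.castLE hk i) x

/-- The cluster mean `μ = (1 / |C|) ∑_{x ∈ C} f x`. -/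
def clusterMean {V : Type*} {k : ℕ} (f : V → EuclideanSpace ℝ (Fin k)) (C : Finset V) :
    EuclideanSpace ℝ (Fin k) :=
  (C.card : ℝ)⁻¹ • ∑ x ∈ C, f x

/-- The empirical mean `(1 / s) ∑ⱼ f (xⱼ)` of a sample `x₁, …, x_s` (with repetitions). -/
def empiricalMean {V : Type*} {k s : ℕ} (f : V → EuclideanSpace ℝ (Fin k)) (x : Fin s → V) :
    EuclideanSpace ℝ (Fin k) :=
  (s : ℝ)⁻¹ • ∑ j, f (x j)

end

end SpectralClustering

/-!
Write `E (g, h) = ⟨g, L h⟩` for the Dirichlet form of the graph.  Two facts about the clustering drive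
the proof. Functions constant on the clusters have energy at most `2 ε ‖g‖²`
(`IsClustering.dirichletForm_comp_label_le`), and by Cheeger's inequality inside each cluster the
energy of any function is at least `φ² / 2` times the sum of its variances within the clusters
(`IsClustering.variance_le_dirichletForm`).  Comparing dimensions, the first `k` eigenvalues are at
most `2 ε` and the others at least `φ² / 2`.  An indicator function of a cluster is therefore almost
spanned by the first `k` eigenvectors, which says that `‖μ‖² ≥ 1 / (2 |C|)`
(`IsClustering.le_norm_clusterMean_sq`).

The coordinates of the embedding have light tails.  If `u` is one of the first `k` eigenvectors and
`p` is even, then the energy of `u ^ p` is at most `p E (u ^ (2 p - 1), u) ≤ 2 p ε ∑ u ^ (2 p)`, so for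
`p ≤ φ² / (8 ε)` the Poincaré inequality yields the reverse Hölder inequality
`∑ u ^ (2 p) ≤ (2 / m) (∑ u ^ p)²`, where `m` is the least size of a cluster
(`IsClustering.sum_pow_two_mul_le`).  Iterating it from `∑ u² = 1` bounds a moment of order about
`φ² / ε`, and Markov's inequality gives the tail bound `IsClustering.card_lt_abs_le`.

Finally each coordinate is truncated at a level that no sampled coordinate exceeds, with probability
`1 - δ / 2`.  By the tail bound the square of this level is `(s k / δ) ^ O(ε / φ²) / m`, which is the
source of the exponents in the sample size; the factor `k ^ O(ε / φ²)` is bounded because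
`ε log k / φ²` is.  Hoeffding's inequality for the truncated coordinates and a union bound over the
`k` coordinates conclude (`le_measureReal_norm_clusterMean_sub_le`).
-/

namespace SpectralClustering

open Finset

/-! ### Cheeger's inequality for weighted finite sets -/

/-- Expansion of small sets implies an `ℓ¹` Poincaré inequality for nonnegative functions with small
support: such a function is a sum of multiples of indicator functions of its superlevel sets, and
both sides are additive along this decomposition (discrete coarea formula). -/
theorem two_mul_sum_le_sum_abs_sub {V : Type*} [DecidableEq V] {w : V → V → ℝ}
    (hw : ∀ x y, 0 ≤ w x y) (hsymm : ∀ x y, w x y = w y x) {C : Finset V} {κ : ℝ}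
    (hκ : ∀ S ⊆ C, S.Nonempty → 2 * S.card ≤ C.card →
      κ * (S.card : ℝ) ≤ ∑ x ∈ S, ∑ y ∈ C \ S, w x y)
    (h : V → ℝ) (h0 : ∀ x ∈ C, 0 ≤ h x)
    (hsupp : 2 * (C.filter fun x => 0 < h x).card ≤ C.card) :
    2 * κ * ∑ x ∈ C, h x ≤ ∑ x ∈ C, ∑ y ∈ C, w x y * |h x - h y| := by
  induction hn : (C.filter fun x => 0 < h x).card using Nat.strong_induction_on generalizing h with
  | _ n ih =>
    set S := C.filter fun x => 0 < h x with hS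
    have hSC : S ⊆ C := filter_subset _ _
    have hout : ∀ x ∈ C, x ∉ S → h x = 0 := fun x hx hxS => by
      have : ¬ 0 < h x := fun hp => hxS (mem_filter.2 ⟨hx, hp⟩)
      linarith [h0 x hx]
    rcases S.eq_empty_or_nonempty with hemp | hne
    · have hz : ∀ x ∈ C, h x = 0 := fun x hx => hout x hx (by simp [hemp])
      rw [sum_eq_zero hz, mul_zero]
      exact sum_nonneg fun x _ => sum_nonneg fun y _ => mul_nonneg (hw x y) (abs_nonneg _)
    obtain ⟨z, hzS, hzmin⟩ := S.exists_min_image h hne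
    have hzpos : 0 < h z := (mem_filter.1 hzS).2
    set a := h z
    -- Lower the function by its least positive value on its support.
    let h' : V → ℝ := fun x => if x ∈ S then h x - a else 0
    have hS' : (C.filter fun x => 0 < h' x) ⊂ S := by
      refine (ssubset_iff_of_subset fun x hx => ?_).2 ⟨z, hzS, fun hz => ?_⟩
      · by_contra hxS
        simp [h', hxS] at hx
      · simp [h', hzS, a] at hz
    have hcard := card_lt_card hS'
    have key := ih _ (hn ▸ hcard) h'
      (fun x _ => by
        by_cases hx : x ∈ S
        · simpa [h', hx] using hzmin x hx
        · simp [h', hx]) (by omega) rfl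
    have hsum : ∑ x ∈ C, h x = ∑ x ∈ C, h' x + a * S.card := by
      have : ∀ x ∈ C, h x = h' x + if x ∈ S then a else 0 := fun x hx => by
        by_cases hxS : x ∈ S
        · simp [h', hxS]
        · simp [h', hxS, hout x hx hxS]
      have hS0 : ∑ x ∈ C, (if x ∈ S then a else 0) = a * S.card := by
        rw [sum_ite_mem, inter_eq_right.2 hSC, sum_const, nsmul_eq_mul, mul_comm]
      rw [sum_congr rfl this, sum_add_distrib, hS0]
    have habs : ∀ x ∈ C, ∀ y ∈ C, w x y * |h x - h y| = w x y * |h' x - h' y|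
        + ((if x ∈ S then (if y ∈ C \ S then a * w x y else 0) else 0)
          + (if y ∈ S then (if x ∈ C \ S then a * w y x else 0) else 0)) := fun x hx y hy => by
      by_cases hxS : x ∈ S <;> by_cases hyS : y ∈ S
      · simp [h', hxS, hyS]
      · have := hzmin x hxS
        simp only [h', hxS, hyS, hout y hy hyS, hy, mem_sdiff, if_true, if_false, sub_zero,
          not_false_eq_true, and_self]
        rw [abs_of_nonneg (h0 x hx), abs_of_nonneg (by linarith)]
        ring
      · have := hzmin y hyS
        simp only [h', hxS, hyS, hout x hx hxS, hx, mem_sdiff, if_true, if_false, zero_sub,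
          not_false_eq_true, and_self, abs_neg]
        rw [abs_of_nonneg (h0 y hy), abs_of_nonneg (by linarith), hsymm y x]
        ring
      · simp [h', hxS, hyS, hout x hx hxS, hout y hy hyS]
    have hS1 : ∑ x ∈ C, ∑ y ∈ C, (if x ∈ S then (if y ∈ C \ S then a * w x y else 0) else 0)
        = a * ∑ x ∈ S, ∑ y ∈ C \ S, w x y := by
      have : ∀ x ∈ C, ∑ y ∈ C, (if x ∈ S then (if y ∈ C \ S then a * w x y else 0) else 0)
          = if x ∈ S then a * ∑ y ∈ C \ S, w x y else 0 := fun x _ => by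
        by_cases hxS : x ∈ S
        · simp only [hxS, if_true]
          rw [sum_ite_mem, inter_eq_right.2 sdiff_subset, mul_sum]
        · simp [hxS]
      rw [sum_congr rfl this, sum_ite_mem, inter_eq_right.2 hSC, mul_sum]
    rw [sum_congr rfl fun x hx => sum_congr rfl fun y hy => habs x hx y hy]
    simp only [sum_add_distrib]
    rw [hS1, sum_comm (f := fun x y => if y ∈ S then (if x ∈ C \ S then a * w y x else 0) else 0),
      hS1, hsum]
    have := mul_le_mul_of_nonneg_left (hκ S hSC hne hsupp) hzpos.le
    linarith

/-- The `ℓ²` version, from the `ℓ¹` version for `h ^ 2` by the Cauchy–Schwarz inequality. -/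
theorem mul_sum_sq_le_of_support {V : Type*} [DecidableEq V] {w : V → V → ℝ}
    (hw : ∀ x y, 0 ≤ w x y) (hsymm : ∀ x y, w x y = w y x) {C : Finset V} {φ d : ℝ}
    (hd : 0 < d) (hφ : 0 ≤ φ) (hdeg : ∀ x ∈ C, ∑ y ∈ C, w x y ≤ d)
    (hκ : ∀ S ⊆ C, S.Nonempty → 2 * S.card ≤ C.card →
      φ * d * (S.card : ℝ) ≤ ∑ x ∈ S, ∑ y ∈ C \ S, w x y)
    (h : V → ℝ) (h0 : ∀ x ∈ C, 0 ≤ h x)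
    (hsupp : 2 * (C.filter fun x => 0 < h x).card ≤ C.card) :
    φ ^ 2 * d * ∑ x ∈ C, h x ^ 2 ≤ ∑ x ∈ C, ∑ y ∈ C, w x y * (h x - h y) ^ 2 := by
  set Q := ∑ x ∈ C, h x ^ 2 with hQ
  set T := ∑ x ∈ C, ∑ y ∈ C, w x y * (h x - h y) ^ 2 with hT
  have hT0 : 0 ≤ T := sum_nonneg fun x _ => sum_nonneg fun y _ => mul_nonneg (hw x y) (sq_nonneg _)
  have hQ0 : 0 ≤ Q := sum_nonneg fun x _ => sq_nonneg _
  have h1 := two_mul_sum_le_sum_abs_sub hw hsymm hκ (fun x => h x ^ 2) (fun x _ => sq_nonneg _) (by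
    refine le_trans (Nat.mul_le_mul_left 2 (card_le_card fun x hx => ?_)) hsupp
    rw [mem_filter] at hx ⊢
    exact ⟨hx.1, lt_of_le_of_ne (h0 x hx.1) fun h => by simp [← h] at hx⟩)
  have hplus : ∑ x ∈ C, ∑ y ∈ C, w x y * (h x + h y) ^ 2 ≤ 4 * d * Q := by
    have e1 : ∀ x ∈ C, ∑ y ∈ C, w x y * h x ^ 2 ≤ d * h x ^ 2 := fun x hx => by
      rw [← sum_mul]
      exact mul_le_mul_of_nonneg_right (hdeg x hx) (sq_nonneg _)
    have e2 : ∑ x ∈ C, ∑ y ∈ C, w x y * h x ^ 2 ≤ d * Q := by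
      rw [hQ, mul_sum]; exact sum_le_sum e1
    have e3 : ∑ x ∈ C, ∑ y ∈ C, w x y * h y ^ 2 ≤ d * Q := by
      rw [sum_comm]; simpa only [hsymm] using e2
    calc ∑ x ∈ C, ∑ y ∈ C, w x y * (h x + h y) ^ 2
        ≤ ∑ x ∈ C, ∑ y ∈ C, (2 * (w x y * h x ^ 2) + 2 * (w x y * h y ^ 2)) := by
          gcongr with x _ y _
          nlinarith [mul_nonneg (hw x y) (sq_nonneg (h x - h y))]
      _ = 2 * (∑ x ∈ C, ∑ y ∈ C, w x y * h x ^ 2) + 2 * ∑ x ∈ C, ∑ y ∈ C, w x y * h y ^ 2 := by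
          simp only [sum_add_distrib, mul_sum]
      _ ≤ _ := by linarith
  have hcs : (∑ x ∈ C, ∑ y ∈ C, w x y * |h x ^ 2 - h y ^ 2|) ^ 2
      ≤ T * ∑ x ∈ C, ∑ y ∈ C, w x y * (h x + h y) ^ 2 := by
    simp only [hT, ← sum_product']
    refine sum_sq_le_sum_mul_sum_of_sq_le_mul _
      (fun p _ => mul_nonneg (hw _ _) (sq_nonneg _))
      (fun p _ => mul_nonneg (hw _ _) (sq_nonneg _)) fun p _ => ?_
    rw [mul_pow, sq_abs]
    exact le_of_eq (by ring)
  have h2 : (2 * (φ * d) * Q) ^ 2 ≤ T * (4 * d * Q) :=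
    (pow_le_pow_left₀ (by positivity) h1 2).trans
      (hcs.trans (mul_le_mul_of_nonneg_left hplus hT0))
  rcases hQ0.eq_or_lt with hz | hpos
  · rw [← hz]; simpa using hT0
  · have : (4 * d * Q) * (φ ^ 2 * d * Q) ≤ (4 * d * Q) * T := by nlinarith
    exact le_of_mul_le_mul_left this (by positivity)

theorem exists_median {V : Type*} (C : Finset V) (g : V → ℝ) :
    ∃ c : ℝ, 2 * (C.filter fun x => c < g x).card ≤ C.card ∧
      2 * (C.filter fun x => g x < c).card ≤ C.card := by
  classical
  rcases C.eq_empty_or_nonempty with rfl | hne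
  · exact ⟨0, by simp⟩
  let T := C.filter fun z => 2 * (C.filter fun x => g z < g x).card ≤ C.card
  obtain ⟨z, hz, hzmax⟩ := C.exists_max_image g hne
  have hT : T.Nonempty := ⟨z, mem_filter.2 ⟨hz, by
    rw [filter_false_of_mem fun x hx => not_lt.2 (hzmax x hx)]; simp⟩⟩
  obtain ⟨c, hc, hcmin⟩ := T.exists_min_image g hT
  refine ⟨g c, (mem_filter.1 hc).2, ?_⟩
  by_contra! hlt
  have hne' : (C.filter fun x => g x < g c).Nonempty := card_pos.1 (by omega)
  obtain ⟨b, hb, hbmax⟩ := exists_max_image _ g hne'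
  have hbC := mem_filter.1 hb
  have hbT : b ∉ T := fun h => absurd (hcmin b h) (not_le.2 hbC.2)
  have h1 : C.card < 2 * (C.filter fun x => g b < g x).card := by
    by_contra! h
    exact hbT (mem_filter.2 ⟨hbC.1, h⟩)
  have h2 : (C.filter fun x => g b < g x) ⊆ C.filter fun x => ¬ g x < g c := fun x hx => by
    rw [mem_filter] at hx ⊢
    exact ⟨hx.1, fun h => absurd (hbmax x (mem_filter.2 ⟨hx.1, h⟩)) (not_le.2 hx.2)⟩
  have h3 := card_le_card h2
  have h4 := card_filter_add_card_filter_not (s := C) (fun x => g x < g c)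
  omega

/-- Cheeger's inequality: expansion of small sets implies a Poincaré inequality.  The positive and
negative parts of `g - c`, for a median `c` of `g`, have small support. -/
theorem mul_variance_le_of_expansion {V : Type*} [DecidableEq V] {w : V → V → ℝ}
    (hw : ∀ x y, 0 ≤ w x y) (hsymm : ∀ x y, w x y = w y x) {C : Finset V} {φ d : ℝ}
    (hd : 0 < d) (hφ : 0 ≤ φ) (hdeg : ∀ x ∈ C, ∑ y ∈ C, w x y ≤ d)
    (hκ : ∀ S ⊆ C, S.Nonempty → 2 * S.card ≤ C.card →
      φ * d * (S.card : ℝ) ≤ ∑ x ∈ S, ∑ y ∈ C \ S, w x y)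
    (g : V → ℝ) :
    φ ^ 2 * d * (∑ x ∈ C, g x ^ 2 - (∑ x ∈ C, g x) ^ 2 / C.card)
      ≤ ∑ x ∈ C, ∑ y ∈ C, w x y * (g x - g y) ^ 2 := by
  obtain ⟨c, hc1, hc2⟩ := exists_median C g
  have hp := mul_sum_sq_le_of_support hw hsymm hd hφ hdeg hκ (fun x => max (g x - c) 0)
    (fun x _ => le_max_right _ _) (by simpa using hc1)
  have hm := mul_sum_sq_le_of_support hw hsymm hd hφ hdeg hκ (fun x => max (c - g x) 0)
    (fun x _ => le_max_right _ _) (by simpa using hc2)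
  have hle : ∑ x ∈ C, ∑ y ∈ C, w x y * (max (g x - c) 0 - max (g y - c) 0) ^ 2
      + ∑ x ∈ C, ∑ y ∈ C, w x y * (max (c - g x) 0 - max (c - g y) 0) ^ 2
      ≤ ∑ x ∈ C, ∑ y ∈ C, w x y * (g x - g y) ^ 2 := by
    simp only [← sum_add_distrib, ← mul_add]
    gcongr with x _ y _
    · exact hw x y
    rcases le_total (g x) c with h1 | h1 <;> rcases le_total (g y) c with h2 | h2 <;>
      simp only [max_eq_left, max_eq_right, sub_nonneg, sub_nonpos, h1, h2] <;> nlinarith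
  have hsq : ∑ x ∈ C, max (g x - c) 0 ^ 2 + ∑ x ∈ C, max (c - g x) 0 ^ 2
      = ∑ x ∈ C, (g x - c) ^ 2 := by
    rw [← sum_add_distrib]
    refine sum_congr rfl fun x _ => ?_
    rcases le_total (g x) c with h1 | h1 <;>
      simp only [max_eq_left, max_eq_right, sub_nonneg, sub_nonpos, h1] <;> ring
  have hvar : ∑ x ∈ C, g x ^ 2 - (∑ x ∈ C, g x) ^ 2 / C.card ≤ ∑ x ∈ C, (g x - c) ^ 2 := by
    rcases C.eq_empty_or_nonempty with rfl | hne
    · simp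
    have hn : (0 : ℝ) < C.card := by exact_mod_cast hne.card_pos
    have e : ∑ x ∈ C, (g x - c) ^ 2 = ∑ x ∈ C, g x ^ 2 - 2 * c * ∑ x ∈ C, g x + C.card * c ^ 2 := by
      simp only [sub_sq, sum_add_distrib, sum_sub_distrib, sum_const, nsmul_eq_mul, mul_sum]
      congr 2
      exact sum_congr rfl fun x _ => by ring
    have : (∑ x ∈ C, g x - C.card * c) ^ 2 / C.card ≥ 0 := by positivity
    have e2 : (∑ x ∈ C, g x - C.card * c) ^ 2 / C.card
        = (∑ x ∈ C, g x) ^ 2 / C.card - 2 * c * ∑ x ∈ C, g x + C.card * c ^ 2 := by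
      field_simp; ring
    linarith
  have := mul_le_mul_of_nonneg_left hvar (by positivity : 0 ≤ φ ^ 2 * d)
  rw [← hsq, mul_add] at this
  linarith

/-! ### The Dirichlet form and clusterings -/

theorem adjMatrix_apply_nonneg {V : Type*} (G : SimpleGraph V) [DecidableRel G.Adj]
    (x y : V) : 0 ≤ G.adjMatrix ℝ x y := by
  rw [SimpleGraph.adjMatrix_apply]; split_ifs <;> norm_num

theorem adjMatrix_apply_comm {V : Type*} (G : SimpleGraph V) [DecidableRel G.Adj]
    (x y : V) : G.adjMatrix ℝ x y = G.adjMatrix ℝ y x := by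
  simp only [SimpleGraph.adjMatrix_apply, G.adj_comm x y]

theorem sum_adjMatrix_apply {V : Type*} [Fintype V] {G : SimpleGraph V} [DecidableRel G.Adj]
    {d : ℕ} (hG : G.IsRegularOfDegree d) (x : V) :
    ∑ y, G.adjMatrix ℝ x y = d := by
  simp only [SimpleGraph.adjMatrix_apply, sum_boole]
  rw [← hG x, ← SimpleGraph.card_neighborFinset_eq_degree]
  congr 2
  ext y; simp

section Dirichlet

variable {V : Type*} [Fintype V] [DecidableEq V] (G : SimpleGraph V) [DecidableRel G.Adj]

/-- The Dirichlet form `⟨g, L h⟩ = (1 / d) ∑_{xy ∈ E} (g x - g y) (h x - h y)` of a `d`-regular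
graph; the sum is over ordered pairs, whence the factor `1 / 2`. -/
noncomputable def dirichletForm (d : ℕ) (g h : V → ℝ) : ℝ :=
  (2 * (d : ℝ))⁻¹ * ∑ x, ∑ y, G.adjMatrix ℝ x y * ((g x - g y) * (h x - h y))

omit [Fintype V] [DecidableEq V] in
theorem card_interedges_eq_sum (S T : Finset V) :
    ((G.interedges S T).card : ℝ) = ∑ x ∈ S, ∑ y ∈ T, G.adjMatrix ℝ x y := by
  simp only [SimpleGraph.adjMatrix_apply]
  rw [← sum_product' S T fun x y => if G.Adj x y then (1 : ℝ) else 0, sum_boole]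
  rfl

omit [DecidableEq V] in
theorem dirichletForm_self_nonneg (d : ℕ) (g : V → ℝ) : 0 ≤ dirichletForm G d g g :=
  mul_nonneg (by positivity) (sum_nonneg fun x _ => sum_nonneg fun y _ =>
    mul_nonneg (adjMatrix_apply_nonneg G x y) (mul_self_nonneg _))

variable {G} in
theorem dirichletForm_eq_dotProduct {d : ℕ} (hd : 0 < d) (hG : G.IsRegularOfDegree d)
    (g h : V → ℝ) :
    dirichletForm G d g h = ∑ x, g x * ((normalizedLaplacian G d).mulVec h) x := by
  have hd' : (d : ℝ) ≠ 0 := by positivity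
  have e1 : ∑ x, ∑ y, G.adjMatrix ℝ x y * (g x * h x) = d * ∑ x, g x * h x := by
    simp only [← sum_mul, sum_adjMatrix_apply hG, mul_sum]
  have e2 : ∑ x, ∑ y, G.adjMatrix ℝ x y * (g y * h y) = d * ∑ x, g x * h x := by
    rw [sum_comm, ← e1]; simp only [adjMatrix_apply_comm G]
  have e3 : ∑ x, ∑ y, G.adjMatrix ℝ x y * (g y * h x)
      = ∑ x, ∑ y, G.adjMatrix ℝ x y * (g x * h y) := by
    rw [sum_comm]; simp only [adjMatrix_apply_comm G]
  have e4 : ∑ x, g x * ((normalizedLaplacian G d).mulVec h) x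
      = ∑ x, g x * h x - (d : ℝ)⁻¹ * ∑ x, ∑ y, G.adjMatrix ℝ x y * (g x * h y) := by
    rw [mul_sum, ← sum_sub_distrib]
    refine sum_congr rfl fun x _ => ?_
    rw [normalizedLaplacian, Matrix.sub_mulVec, Matrix.one_mulVec, Matrix.smul_mulVec]
    simp only [Pi.sub_apply, Pi.smul_apply, smul_eq_mul, Matrix.mulVec, dotProduct, mul_sub,
      mul_sum]
    congr 1
    exact sum_congr rfl fun y _ => by ring
  have e5 : ∑ x, ∑ y, G.adjMatrix ℝ x y * ((g x - g y) * (h x - h y))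
      = ∑ x, ∑ y, G.adjMatrix ℝ x y * (g x * h x) + ∑ x, ∑ y, G.adjMatrix ℝ x y * (g y * h y)
        - ∑ x, ∑ y, G.adjMatrix ℝ x y * (g y * h x)
        - ∑ x, ∑ y, G.adjMatrix ℝ x y * (g x * h y) := by
    simp only [← sum_add_distrib, ← sum_sub_distrib]
    exact sum_congr rfl fun x _ => sum_congr rfl fun y _ => by ring
  rw [dirichletForm, e4, e5, e3, e1, e2]
  field_simp
  ring

end Dirichlet

section Clustering

variable {V : Type*} [Fintype V] [DecidableEq V] {G : SimpleGraph V} [DecidableRel G.Adj]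
  {d k : ℕ} {φ ε R : ℝ} {C : Fin k → Finset V}

theorem IsClustering.exists_label (hC : IsClustering G d k φ ε R C) :
    ∃ cl : V → Fin k, ∀ x i, x ∈ C i ↔ cl x = i := by
  choose cl hcl using hC.cover
  refine ⟨cl, fun x i => ⟨fun hx => ?_, fun h => h ▸ hcl x⟩⟩
  by_contra hne
  exact (Finset.disjoint_left.1 (hC.disjoint _ _ hne)) (hcl x) hx

theorem IsClustering.sum_eq (hC : IsClustering G d k φ ε R C) (F : V → ℝ) :
    ∑ x, F x = ∑ i, ∑ x ∈ C i, F x := by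
  obtain ⟨cl, hcl⟩ := hC.exists_label
  rw [← sum_fiberwise univ cl F]
  refine sum_congr rfl fun i _ => sum_congr ?_ fun _ _ => rfl
  ext x; simp [hcl]

omit [Fintype V] in
theorem le_sum_of_le_internalConductance (hd : 0 < d) {C : Finset V}
    (hφ : φ ≤ internalConductance G d C) {S : Finset V} (hS : S ⊆ C) (hne : S.Nonempty)
    (hcard : 2 * S.card ≤ C.card) :
    φ * d * (S.card : ℝ) ≤ ∑ x ∈ S, ∑ y ∈ C \ S, G.adjMatrix ℝ x y := by
  have h0 := hne.card_pos
  rw [internalConductance, dif_pos (by omega)] at hφ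
  have h1 : φ ≤ conductanceWithin G d C S := (le_inf'_iff _ _).1 hφ S (by
    simp only [smallSubsets, mem_filter, mem_powerset]
    exact ⟨hS, h0, hcard⟩)
  have hpos : 0 < (d : ℝ) * S.card := by positivity
  rw [conductanceWithin, le_div_iff₀ hpos, card_interedges_eq_sum] at h1
  linarith

/-- Poincaré inequality: the Dirichlet form controls the variances within the clusters.  It is
Cheeger's inequality applied inside each cluster, the edges between clusters being discarded. -/
theorem IsClustering.variance_le_dirichletForm (hC : IsClustering G d k φ ε R C) (hd : 0 < d)
    (hG : G.IsRegularOfDegree d) (hφ : 0 ≤ φ) (g : V → ℝ) :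
    φ ^ 2 / 2 * (∑ x, g x ^ 2 - ∑ i, (∑ x ∈ C i, g x) ^ 2 / (C i).card)
      ≤ dirichletForm G d g g := by
  have hd' : (0 : ℝ) < d := by positivity
  have h1 : ∀ i, φ ^ 2 * d * (∑ x ∈ C i, g x ^ 2 - (∑ x ∈ C i, g x) ^ 2 / (C i).card)
      ≤ ∑ x ∈ C i, ∑ y, G.adjMatrix ℝ x y * ((g x - g y) * (g x - g y)) := fun i => by
    refine (mul_variance_le_of_expansion (w := fun x y => G.adjMatrix ℝ x y)
      (adjMatrix_apply_nonneg G) (adjMatrix_apply_comm G) hd' hφ (fun x _ => ?_)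
      (fun S hS hne hc => le_sum_of_le_internalConductance hd (hC.internal i) hS hne hc) g).trans ?_
    · rw [← sum_adjMatrix_apply hG x]
      exact sum_le_univ_sum_of_nonneg fun y => adjMatrix_apply_nonneg G x y
    · refine sum_le_sum fun x _ => ?_
      simp only [sq]
      exact sum_le_univ_sum_of_nonneg fun y =>
        mul_nonneg (adjMatrix_apply_nonneg G x y) (mul_self_nonneg _)
  have h2 := sum_le_sum fun i (_ : i ∈ univ) => h1 i
  rw [← mul_sum, sum_sub_distrib, ← hC.sum_eq, ← hC.sum_eq] at h2
  rw [dirichletForm, mul_comm (2 * (d : ℝ))⁻¹, ← div_eq_mul_inv, le_div_iff₀ (by positivity)]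
  linarith

/-- Functions constant on the clusters have small energy.  An edge between two clusters carries
`(a - b) ^ 2 ≤ 2 * (a ^ 2 + b ^ 2)`, and each cluster has few such edges. -/
theorem IsClustering.dirichletForm_comp_label_le (hC : IsClustering G d k φ ε R C) (hd : 0 < d)
    {cl : V → Fin k} (hcl : ∀ x i, x ∈ C i ↔ cl x = i) (c : Fin k → ℝ) :
    dirichletForm G d (c ∘ cl) (c ∘ cl) ≤ 2 * ε * ∑ x, c (cl x) ^ 2 := by
  have hd' : (0 : ℝ) < d := by positivity
  let B : V → V → ℝ := fun x y => if cl x = cl y then 0 else G.adjMatrix ℝ x y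
  have hB0 : ∀ x y, 0 ≤ B x y := fun x y => by
    by_cases h : cl x = cl y <;> simp only [B, h, if_true, if_false, le_refl]
    exact adjMatrix_apply_nonneg G x y
  have hBsymm : ∀ x y, B x y = B y x := fun x y => by
    simp only [B, eq_comm (a := cl x), adjMatrix_apply_comm G x y]
  have h1 : ∑ x, ∑ y, B x y * c (cl x) ^ 2 ≤ ε * d * ∑ x, c (cl x) ^ 2 := by
    rw [hC.sum_eq, hC.sum_eq, mul_sum]
    refine sum_le_sum fun i _ => ?_
    have e1 : ∑ x ∈ C i, ∑ y, B x y * c (cl x) ^ 2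
        = ((G.interedges (C i) (univ \ C i)).card : ℝ) * c i ^ 2 := by
      rw [card_interedges_eq_sum, sum_mul]
      refine sum_congr rfl fun x hx => ?_
      rw [(hcl x i).1 hx, ← sum_mul]
      congr 1
      rw [← sum_subset (sdiff_subset (s := univ) (t := C i)) fun y _ hy => ?_]
      · refine sum_congr rfl fun y hy => if_neg fun h => ?_
        exact (mem_sdiff.1 hy).2 ((hcl y i).2 (h ▸ (hcl x i).1 hx))
      · refine if_pos ?_
        have : y ∈ C i := by simpa using hy
        rw [(hcl x i).1 hx, (hcl y i).1 this]
    have e2 : ∑ x ∈ C i, c (cl x) ^ 2 = (C i).card * c i ^ 2 := by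
      rw [sum_congr rfl fun x hx => by rw [(hcl x i).1 hx], sum_const, nsmul_eq_mul]
    have hn : (0 : ℝ) < (C i).card := by exact_mod_cast (hC.nonempty i).card_pos
    have h3 := hC.external i
    rw [externalConductance, conductanceWithin, div_le_iff₀ (by positivity)] at h3
    rw [e1, e2]
    nlinarith [mul_le_mul_of_nonneg_right h3 (sq_nonneg (c i))]
  have h1' : ∑ x, ∑ y, B x y * c (cl y) ^ 2 ≤ ε * d * ∑ x, c (cl x) ^ 2 := by
    rw [sum_comm]; simpa only [hBsymm] using h1
  have h2 : ∑ x, ∑ y, G.adjMatrix ℝ x y * ((c (cl x) - c (cl y)) * (c (cl x) - c (cl y)))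
      ≤ ∑ x, ∑ y, (2 * (B x y * c (cl x) ^ 2) + 2 * (B x y * c (cl y) ^ 2)) := by
    refine sum_le_sum fun x _ => sum_le_sum fun y _ => ?_
    by_cases h : cl x = cl y
    · simp [B, h]
    · have : B x y = G.adjMatrix ℝ x y := if_neg h
      rw [← this]
      nlinarith [mul_nonneg (hB0 x y) (sq_nonneg (c (cl x) + c (cl y)))]
  simp only [sum_add_distrib, ← mul_sum] at h2
  rw [dirichletForm, mul_comm (2 * (d : ℝ))⁻¹, ← div_eq_mul_inv, div_le_iff₀ (by positivity)]
  simp only [Function.comp_apply]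
  linarith

end Clustering

/-! ### Eigenvalues, cluster means and moments of eigenvectors -/

section Spectrum

variable {V : Type*} [Fintype V] [DecidableEq V] {G : SimpleGraph V} [DecidableRel G.Adj]
  {d : ℕ} {u : OrthonormalBasis (Fin (Fintype.card V)) ℝ (EuclideanSpace ℝ V)}
  {ev : Fin (Fintype.card V) → ℝ}

theorem dirichletForm_eigenvector (hd : 0 < d) (hG : G.IsRegularOfDegree d)
    (hu : ∀ j, Matrix.toEuclideanLin (normalizedLaplacian G d) (u j) = ev j • u j)
    (g : V → ℝ) (j : Fin (Fintype.card V)) :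
    dirichletForm G d g (u j) = ev j * ∑ x, g x * u j x := by
  have h := hu j
  rw [dirichletForm_eq_dotProduct hd hG, mul_sum]
  refine sum_congr rfl fun x _ => ?_
  have hx : ((normalizedLaplacian G d).mulVec (u j)) x = ev j * u j x := by
    have := congrArg (fun v : EuclideanSpace ℝ V => v x) h
    simpa [Matrix.toEuclideanLin] using this
  rw [hx]; ring

omit [DecidableEq V] in
theorem sum_coeff_mul (g h : V → ℝ) :
    ∑ j, (∑ x, g x * u j x) * (∑ x, h x * u j x) = ∑ x, g x * h x := by
  have := u.sum_inner_mul_inner (WithLp.toLp 2 g) (WithLp.toLp 2 h)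
  simp only [PiLp.inner_apply, RCLike.inner_apply, conj_trivial] at this
  simp only [mul_comm] at this ⊢
  simpa only [mul_comm] using this

omit [DecidableEq V] in
theorem sum_coeff_sq (g : V → ℝ) : ∑ j, (∑ x, g x * u j x) ^ 2 = ∑ x, g x ^ 2 := by
  simpa only [sq] using sum_coeff_mul (u := u) g g

omit [DecidableEq V] in
theorem sum_basis_sq (j : Fin (Fintype.card V)) : ∑ x, u j x ^ 2 = 1 := by
  have := u.orthonormal.1 j
  rw [EuclideanSpace.norm_eq, Real.sqrt_eq_one] at this
  simpa using this

theorem dirichletForm_self_eq_sum (hd : 0 < d) (hG : G.IsRegularOfDegree d)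
    (hu : ∀ j, Matrix.toEuclideanLin (normalizedLaplacian G d) (u j) = ev j • u j) (g : V → ℝ) :
    dirichletForm G d g g = ∑ j, ev j * (∑ x, g x * u j x) ^ 2 := by
  rw [dirichletForm_eq_dotProduct hd hG, ← sum_coeff_mul (u := u)]
  refine sum_congr rfl fun j _ => ?_
  have h1 := dirichletForm_eigenvector hd hG hu g j
  have h2 : dirichletForm G d (u j) g = dirichletForm G d g (u j) := by
    simp only [dirichletForm, mul_comm]
  rw [dirichletForm_eq_dotProduct hd hG] at h2
  simp only [mul_comm _ (u j _)] at h1 h2 ⊢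
  rw [h2, h1]; ring

theorem eigenvalue_nonneg (hd : 0 < d) (hG : G.IsRegularOfDegree d)
    (hu : ∀ j, Matrix.toEuclideanLin (normalizedLaplacian G d) (u j) = ev j • u j)
    (j : Fin (Fintype.card V)) : 0 ≤ ev j := by
  have h := dirichletForm_self_nonneg G d (u j)
  rw [dirichletForm_eigenvector hd hG hu] at h
  simpa only [← sq, sum_basis_sq, mul_one] using h

end Spectrum

section ClusteringSpectrum

variable {V : Type*} [Fintype V] [DecidableEq V] {G : SimpleGraph V} [DecidableRel G.Adj]
  {d k : ℕ} {φ ε R : ℝ} {C : Fin k → Finset V}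
  {u : OrthonormalBasis (Fin (Fintype.card V)) ℝ (EuclideanSpace ℝ V)}
  {ev : Fin (Fintype.card V) → ℝ}

/-- The first `k` eigenvalues are at most `2 * ε`: the `k`-dimensional space of functions that are
constant on the clusters has small energy. -/
theorem IsClustering.eigenvalue_le (hC : IsClustering G d k φ ε R C) (hd : 0 < d)
    (hG : G.IsRegularOfDegree d) (hmono : Monotone ev)
    (hu : ∀ j, Matrix.toEuclideanLin (normalizedLaplacian G d) (u j) = ev j • u j)
    {j : Fin (Fintype.card V)} (hj : (j : ℕ) < k) : ev j ≤ 2 * ε := by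
  by_contra! hlt
  obtain ⟨cl, hcl⟩ := hC.exists_label
  let Φ : (Fin k → ℝ) →ₗ[ℝ] ({l : Fin (Fintype.card V) // l < j} → ℝ) :=
    { toFun := fun c l => ∑ x, c (cl x) * u l x
      map_add' := fun a b => by ext l; simp [add_mul, sum_add_distrib]
      map_smul' := fun a b => by ext l; simp [mul_assoc, mul_sum] }
  have hker := LinearMap.ker_ne_bot_of_finrank_lt (f := Φ) (by
    have : (univ.filter fun l => l < j) = Iio j := by ext; simp
    simpa [Fintype.card_subtype, this] using hj)
  obtain ⟨c, hc, hc0⟩ := Submodule.exists_mem_ne_zero_of_ne_bot hker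
  have hz : ∀ l, l < j → ∑ x, c (cl x) * u l x = 0 := fun l hl => congrFun hc ⟨l, hl⟩
  have hpos : 0 < ∑ x, c (cl x) ^ 2 := by
    obtain ⟨i, hi⟩ := Function.ne_iff.1 hc0
    obtain ⟨x, hx⟩ := hC.nonempty i
    refine sum_pos' (fun _ _ => sq_nonneg _) ⟨x, mem_univ _, ?_⟩
    rw [(hcl x i).1 hx]
    exact sq_pos_of_ne_zero hi
  have h1 := hC.dirichletForm_comp_label_le hd hcl c
  rw [dirichletForm_self_eq_sum hd hG hu] at h1
  have h2 : ev j * ∑ x, c (cl x) ^ 2 ≤ ∑ l, ev l * (∑ x, (c ∘ cl) x * u l x) ^ 2 := by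
    rw [← sum_coeff_sq (u := u) (fun x => c (cl x)), mul_sum]
    refine sum_le_sum fun l _ => ?_
    rcases lt_or_ge l j with hl | hl
    · simp [hz l hl]
    · exact mul_le_mul_of_nonneg_right (hmono hl) (sq_nonneg _)
  have := mul_lt_mul_of_pos_right hlt hpos
  linarith

/-- The remaining eigenvalues are at least `φ ^ 2 / 2`: among the functions spanned by the first
`j + 1 > k` eigenvectors one has mean zero on every cluster, and the Poincaré inequality applies. -/
theorem IsClustering.le_eigenvalue (hC : IsClustering G d k φ ε R C) (hd : 0 < d)
    (hG : G.IsRegularOfDegree d) (hφ : 0 ≤ φ) (hmono : Monotone ev)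
    (hu : ∀ j, Matrix.toEuclideanLin (normalizedLaplacian G d) (u j) = ev j • u j)
    {j : Fin (Fintype.card V)} (hj : k ≤ (j : ℕ)) : φ ^ 2 / 2 ≤ ev j := by
  by_contra! hlt
  let Φ : (V → ℝ) →ₗ[ℝ] ({l : Fin (Fintype.card V) // j < l} ⊕ Fin k → ℝ) :=
    { toFun := fun g => Sum.elim (fun l => ∑ x, g x * u l x) (fun i => ∑ x ∈ C i, g x)
      map_add' := fun a b => by ext (l | l) <;> simp [add_mul, sum_add_distrib]
      map_smul' := fun a b => by ext (l | l) <;> simp [mul_assoc, mul_sum] }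
  have hker := LinearMap.ker_ne_bot_of_finrank_lt (f := Φ) (by
    have hIoi : (univ.filter fun l => j < l) = Ioi j := by ext; simp
    have := j.2
    simp only [Module.finrank_fintype_fun_eq_card, Fintype.card_sum, Fintype.card_subtype, hIoi,
      Fin.card_Ioi, Fintype.card_fin]
    omega)
  obtain ⟨g, hg, hg0⟩ := Submodule.exists_mem_ne_zero_of_ne_bot hker
  have hz : ∀ l, j < l → ∑ x, g x * u l x = 0 := fun l hl => congrFun hg (Sum.inl ⟨l, hl⟩)
  have hm : ∀ i, ∑ x ∈ C i, g x = 0 := fun i => congrFun hg (Sum.inr i)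
  have hpos : 0 < ∑ x, g x ^ 2 := by
    obtain ⟨x, hx⟩ := Function.ne_iff.1 hg0
    exact sum_pos' (fun _ _ => sq_nonneg _) ⟨x, mem_univ _, sq_pos_of_ne_zero hx⟩
  have h1 := hC.variance_le_dirichletForm hd hG hφ g
  simp only [hm, zero_pow two_ne_zero, zero_div, sum_const_zero, sub_zero] at h1
  rw [dirichletForm_self_eq_sum hd hG hu] at h1
  have h2 : ∑ l, ev l * (∑ x, g x * u l x) ^ 2 ≤ ev j * ∑ x, g x ^ 2 := by
    rw [← sum_coeff_sq (u := u) g, mul_sum]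
    refine sum_le_sum fun l _ => ?_
    rcases lt_or_ge j l with hl | hl
    · simp [hz l hl]
    · exact mul_le_mul_of_nonneg_right (hmono hl) (sq_nonneg _)
  have := mul_lt_mul_of_pos_right hlt hpos
  linarith

/-- The cluster means are long: an indicator function of a cluster is almost contained in the span
of the first `k` eigenvectors. -/
theorem IsClustering.le_norm_clusterMean_sq (hC : IsClustering G d k φ ε R C) (hd : 0 < d)
    (hG : G.IsRegularOfDegree d) (hφ : 0 < φ) (hmono : Monotone ev)
    (hu : ∀ j, Matrix.toEuclideanLin (normalizedLaplacian G d) (u j) = ev j • u j)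
    (hk : k ≤ Fintype.card V) {f : V → EuclideanSpace ℝ (Fin k)}
    (hf : ∀ x i, f x i = u (Fin.castLE hk i) x) (i : Fin k) :
    (1 - 4 * ε / φ ^ 2) / (C i).card ≤ ‖clusterMean f (C i)‖ ^ 2 := by
  obtain ⟨cl, hcl⟩ := hC.exists_label
  have hn : (0 : ℝ) < (C i).card := by exact_mod_cast (hC.nonempty i).card_pos
  let c : Fin k → ℝ := fun l => if l = i then 1 else 0
  have hCi : C i = univ.filter fun x => cl x = i := by ext x; simp [hcl]
  have hind : ∀ F : V → ℝ, ∑ x, c (cl x) * F x = ∑ x ∈ C i, F x := fun F => by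
    rw [hCi, sum_filter]
    simp [c]
  have hsq : ∑ x, c (cl x) ^ 2 = (C i).card := by
    simp [c, hCi]
  have hS := sum_coeff_sq (u := u) (c ∘ cl)
  have hE := hC.dirichletForm_comp_label_le hd hcl c
  rw [dirichletForm_self_eq_sum hd hG hu, hsq] at hE
  simp only [Function.comp_apply, hind, hsq] at hS hE
  let T : Finset (Fin (Fintype.card V)) := univ.filter fun j => ¬ (j : ℕ) < k
  have hsplit : ∑ j, (∑ x ∈ C i, u j x) ^ 2
      = ∑ l : Fin k, (∑ x ∈ C i, u (Fin.castLE hk l) x) ^ 2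
        + ∑ j ∈ T, (∑ x ∈ C i, u j x) ^ 2 := by
    rw [← sum_filter_add_sum_filter_not univ (fun j : Fin (Fintype.card V) => (j : ℕ) < k)]
    congr 1
    have : (univ.filter fun j : Fin (Fintype.card V) => (j : ℕ) < k)
        = univ.map (Fin.castLEEmb hk) := by
      ext j
      simp only [mem_filter, mem_univ, true_and, mem_map, Fin.castLEEmb_apply]
      exact ⟨fun h => ⟨⟨j, h⟩, rfl⟩, fun ⟨l, hl⟩ => hl ▸ l.2⟩
    rw [this, sum_map]
    rfl
  have htail : φ ^ 2 / 2 * ∑ j ∈ T, (∑ x ∈ C i, u j x) ^ 2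
      ≤ 2 * ε * (C i).card := by
    refine le_trans ?_ hE
    rw [mul_sum]
    refine (sum_le_sum fun j hj => ?_).trans (sum_le_sum_of_subset_of_nonneg (subset_univ _)
      fun j _ _ => mul_nonneg (eigenvalue_nonneg hd hG hu j) (sq_nonneg _))
    exact mul_le_mul_of_nonneg_right
      (hC.le_eigenvalue hd hG hφ.le hmono hu (not_lt.1 (mem_filter.1 hj).2)) (sq_nonneg _)
  have hnorm : ‖clusterMean f (C i)‖ ^ 2
      = (∑ l : Fin k, (∑ x ∈ C i, u (Fin.castLE hk l) x) ^ 2) / ((C i).card : ℝ) ^ 2 := by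
    rw [EuclideanSpace.norm_sq_eq, sum_div]
    refine sum_congr rfl fun l _ => ?_
    simp only [clusterMean, PiLp.smul_apply, WithLp.ofLp_sum, Finset.sum_apply, hf, smul_eq_mul,
      Real.norm_eq_abs, sq_abs]
    rw [mul_pow, inv_pow]; ring
  rw [hnorm, div_le_div_iff₀ hn (by positivity)]
  have hφ2 : 0 < φ ^ 2 := by positivity
  have h3 : ∑ j ∈ T, (∑ x ∈ C i, u j x) ^ 2 ≤ 4 * ε / φ ^ 2 * (C i).card := by
    rw [div_mul_eq_mul_div, le_div_iff₀ hφ2]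
    linarith
  have h4 : (1 - 4 * ε / φ ^ 2) * (C i).card
      ≤ ∑ l : Fin k, (∑ x ∈ C i, u (Fin.castLE hk l) x) ^ 2 := by linarith
  rw [sq ((C i).card : ℝ), ← mul_assoc]
  exact mul_le_mul_of_nonneg_right h4 hn.le

/-- The elementary inequality behind the Stroock–Varopoulos inequality for Dirichlet forms.  For
`a, b ≥ 0`, divide by `(a - b) ^ 2` and apply the Cauchy–Schwarz inequality to the geometric sum
`(a ^ p - b ^ p) / (a - b)`. -/
theorem pow_sub_pow_sq_le {p : ℕ} (hp : Even p) (hp0 : 0 < p) (a b : ℝ) :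
    (a ^ p - b ^ p) ^ 2 ≤ p * ((a ^ (2 * p - 1) - b ^ (2 * p - 1)) * (a - b)) := by
  have key : ∀ a b : ℝ, 0 ≤ a → 0 ≤ b →
      (a ^ p - b ^ p) ^ 2 ≤ p * ((a ^ (2 * p - 1) - b ^ (2 * p - 1)) * (a - b)) := by
    intro a b ha hb
    rcases (add_nonneg ha hb).eq_or_lt with h0 | hpos
    · have ha0 : a = 0 := by linarith
      have hb0 : b = 0 := by linarith
      simp [ha0, hb0]
    have hpe : 2 * p - 1 = (2 * p - 2) + 1 := by omega
    have hpe' : 2 * p = (2 * p - 2) + 2 := by omega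
    set S := ∑ i ∈ range p, a ^ i * b ^ (p - 1 - i) with hS
    set E := ∑ i ∈ range p, (a ^ 2) ^ i * (b ^ 2) ^ (p - 1 - i) with hE
    have h1 : S * (a - b) = a ^ p - b ^ p := by rw [hS, (Commute.all a b).geom_sum₂_mul]
    have h2 : E * (a ^ 2 - b ^ 2) = a ^ (2 * p) - b ^ (2 * p) := by
      rw [hE, (Commute.all (a ^ 2) (b ^ 2)).geom_sum₂_mul, ← pow_mul, ← pow_mul]
    have h3 : S ^ 2 ≤ p * E := by
      have := sq_sum_le_card_mul_sum_sq (s := range p) (f := fun i => a ^ i * b ^ (p - 1 - i))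
      rw [card_range] at this
      refine this.trans_eq ?_
      congr 1
      exact sum_congr rfl fun i _ => by ring
    have h4 : 0 ≤ (a - b) * (a ^ (2 * p - 2) - b ^ (2 * p - 2)) := by
      rcases le_total a b with h | h
      · exact mul_nonneg_of_nonpos_of_nonpos (by linarith)
          (by linarith [pow_le_pow_left₀ ha h (2 * p - 2)])
      · exact mul_nonneg (by linarith) (by linarith [pow_le_pow_left₀ hb h (2 * p - 2)])
    have h5 : E * (a - b) ^ 2 ≤ (a ^ (2 * p - 1) - b ^ (2 * p - 1)) * (a - b) := by
      refine le_of_mul_le_mul_left ?_ hpos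
      have e1 : (a + b) * (E * (a - b) ^ 2) = (a - b) * (E * (a ^ 2 - b ^ 2)) := by ring
      rw [e1, h2, hpe, hpe', pow_succ, pow_succ, pow_add, pow_add, Nat.add_sub_cancel]
      have h6 := mul_nonneg (mul_nonneg ha hb) h4
      linear_combination h6
    calc (a ^ p - b ^ p) ^ 2 = S ^ 2 * (a - b) ^ 2 := by rw [← h1]; ring
      _ ≤ p * E * (a - b) ^ 2 := mul_le_mul_of_nonneg_right h3 (sq_nonneg _)
      _ = p * (E * (a - b) ^ 2) := by ring
      _ ≤ _ := mul_le_mul_of_nonneg_left h5 (Nat.cast_nonneg p)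
  -- Passing to absolute values does not change the left-hand side, as `p` is even, and only
  -- decreases the right-hand side.
  have h := key |a| |b| (abs_nonneg a) (abs_nonneg b)
  rw [hp.pow_abs, hp.pow_abs] at h
  refine h.trans (mul_le_mul_of_nonneg_left ?_ (by positivity))
  have hpe : 2 * p - 1 = (2 * p - 2) + 1 := by omega
  have heven : Even (2 * p - 2) := ⟨p - 1, by omega⟩
  rw [hpe, pow_succ, pow_succ, pow_succ, pow_succ, heven.pow_abs, heven.pow_abs]
  have ha := heven.pow_nonneg a
  have hb := heven.pow_nonneg b
  have h1 : a * b ≤ |a| * |b| := by rw [← abs_mul]; exact le_abs_self _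
  have h2 := abs_mul_abs_self a
  have h3 := abs_mul_abs_self b
  have e1 : (a ^ (2 * p - 2) * |a| - b ^ (2 * p - 2) * |b|) * (|a| - |b|)
      = a ^ (2 * p - 2) * (|a| * |a|) + b ^ (2 * p - 2) * (|b| * |b|)
        - (a ^ (2 * p - 2) + b ^ (2 * p - 2)) * (|a| * |b|) := by ring
  rw [e1, h2, h3]
  nlinarith [mul_le_mul_of_nonneg_left h1 (add_nonneg ha hb)]

omit [DecidableEq V] in
theorem dirichletForm_pow_le (G : SimpleGraph V) [DecidableRel G.Adj] (d : ℕ) {p : ℕ}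
    (hp : Even p) (hp0 : 0 < p) (v : V → ℝ) :
    dirichletForm G d (fun x => v x ^ p) (fun x => v x ^ p)
      ≤ p * dirichletForm G d (fun x => v x ^ (2 * p - 1)) v := by
  rw [dirichletForm, dirichletForm, mul_left_comm (p : ℝ)]
  refine mul_le_mul_of_nonneg_left ?_ (by positivity)
  rw [mul_sum]
  refine sum_le_sum fun x _ => ?_
  rw [mul_sum]
  refine sum_le_sum fun y _ => ?_
  rw [mul_left_comm (p : ℝ)]
  refine mul_le_mul_of_nonneg_left ?_ (adjMatrix_apply_nonneg G x y)
  rw [← sq]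
  exact pow_sub_pow_sq_le hp hp0 _ _

/-- Reverse Hölder inequality for eigenvectors with small eigenvalue: the energy of `u ^ p` is at
most `p` times the eigenvalue, so the Poincaré inequality bounds its second moment by its first. -/
theorem IsClustering.sum_pow_two_mul_le (hC : IsClustering G d k φ ε R C) (hd : 0 < d)
    (hG : G.IsRegularOfDegree d) (hφ : 0 < φ) (hmono : Monotone ev)
    (hu : ∀ j, Matrix.toEuclideanLin (normalizedLaplacian G d) (u j) = ev j • u j)
    {j : Fin (Fintype.card V)} (hj : (j : ℕ) < k) {m : ℝ} (hm : 0 < m)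
    (hmC : ∀ i, m ≤ (C i).card) {p : ℕ} (hp : Even p) (hp0 : 0 < p)
    (hpε : 8 * p * ε ≤ φ ^ 2) :
    ∑ x, u j x ^ (2 * p) ≤ 2 / m * (∑ x, u j x ^ p) ^ 2 := by
  set T := ∑ x, u j x ^ (2 * p) with hT
  have hT0 : 0 ≤ T := sum_nonneg fun x _ => (even_two_mul p).pow_nonneg _
  have hE : dirichletForm G d (fun x => u j x ^ p) (fun x => u j x ^ p) ≤ p * (2 * ε * T) := by
    refine (dirichletForm_pow_le G d hp hp0 _).trans (mul_le_mul_of_nonneg_left ?_ (by positivity))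
    have e : dirichletForm G d (fun x => u j x ^ (2 * p - 1)) (u j) = ev j * T := by
      rw [dirichletForm_eigenvector hd hG hu, hT]
      congr 1
      refine sum_congr rfl fun x _ => ?_
      rw [← pow_succ]; congr 1; omega
    rw [e]
    exact mul_le_mul_of_nonneg_right (hC.eigenvalue_le hd hG hmono hu hj) hT0
  have hP := (hC.variance_le_dirichletForm hd hG hφ.le fun x => u j x ^ p).trans hE
  have hTe : ∑ x, (u j x ^ p) ^ 2 = T := sum_congr rfl fun x _ => by
    rw [← pow_mul, mul_comm]
  rw [hTe] at hP
  have hnn : ∀ i, 0 ≤ ∑ x ∈ C i, u j x ^ p := fun i => sum_nonneg fun x _ => hp.pow_nonneg _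
  have hmeans : ∑ i, (∑ x ∈ C i, u j x ^ p) ^ 2 / (C i).card ≤ (∑ x, u j x ^ p) ^ 2 / m := by
    calc ∑ i, (∑ x ∈ C i, u j x ^ p) ^ 2 / (C i).card
        ≤ ∑ i, (∑ x ∈ C i, u j x ^ p) ^ 2 / m :=
          sum_le_sum fun i _ => div_le_div_of_nonneg_left (sq_nonneg _) hm (hmC i)
      _ = (∑ i, (∑ x ∈ C i, u j x ^ p) ^ 2) / m := by rw [sum_div]
      _ ≤ (∑ i, ∑ x ∈ C i, u j x ^ p) ^ 2 / m :=
          div_le_div_of_nonneg_right (sum_sq_le_sq_sum_of_nonneg fun i _ => hnn i) hm.le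
      _ = _ := by rw [← hC.sum_eq]
  have hφ2 : 0 < φ ^ 2 := by positivity
  have h1 : p * (2 * ε * T) ≤ φ ^ 2 / 2 * (T / 2) := by
    nlinarith [mul_le_mul_of_nonneg_right hpε hT0]
  have h2 := le_of_mul_le_mul_left (hP.trans h1) (by positivity)
  rw [div_mul_eq_mul_div, mul_div_assoc]
  linarith

/-- Iterated reverse Hölder inequality: the moments whose order is a power of two and at most
`φ ^ 2 / (4 * ε)` are bounded by those of a unit vector of constant modulus on `m / 2` points. -/
theorem IsClustering.sum_pow_two_pow_le (hC : IsClustering G d k φ ε R C) (hd : 0 < d)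
    (hG : G.IsRegularOfDegree d) (hφ : 0 < φ) (hε : 0 ≤ ε) (hmono : Monotone ev)
    (hu : ∀ j, Matrix.toEuclideanLin (normalizedLaplacian G d) (u j) = ev j • u j)
    {j : Fin (Fintype.card V)} (hj : (j : ℕ) < k) {m : ℝ} (hm : 0 < m)
    (hmC : ∀ i, m ≤ (C i).card) (r : ℕ) (hr : 4 * 2 ^ (r + 1) * ε ≤ φ ^ 2) :
    2 / m * ∑ x, u j x ^ 2 ^ (r + 1) ≤ (2 / m) ^ 2 ^ r := by
  induction r with
  | zero => simp [sum_basis_sq]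
  | succ r ih =>
    have hr' : 4 * 2 ^ (r + 1) * ε ≤ φ ^ 2 := by
      refine le_trans ?_ hr
      have : (0 : ℝ) ≤ 2 ^ (r + 1) * ε := by positivity
      rw [pow_succ _ (r + 1)]; linarith
    have h1 := hC.sum_pow_two_mul_le hd hG hφ hmono hu hj hm hmC (p := 2 ^ (r + 1))
      ⟨2 ^ r, by ring⟩ (by positivity) (by push_cast; rw [pow_succ] at hr; linarith)
    have h2 := ih hr'
    have hnn : 0 ≤ 2 / m * ∑ x, u j x ^ 2 ^ (r + 1) :=
      mul_nonneg (by positivity) (sum_nonneg fun x _ =>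
        Even.pow_nonneg (⟨2 ^ r, by ring⟩ : Even (2 ^ (r + 1))) _)
    calc 2 / m * ∑ x, u j x ^ 2 ^ (r + 1 + 1)
        = 2 / m * ∑ x, u j x ^ (2 * 2 ^ (r + 1)) := by rw [pow_succ' 2 (r + 1)]
      _ ≤ 2 / m * (2 / m * (∑ x, u j x ^ 2 ^ (r + 1)) ^ 2) := by gcongr
      _ = (2 / m * ∑ x, u j x ^ 2 ^ (r + 1)) ^ 2 := by ring
      _ ≤ ((2 / m) ^ 2 ^ r) ^ 2 := pow_le_pow_left₀ hnn h2 2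
      _ = _ := by rw [← pow_mul, pow_succ]

/-- Tail bound for the first `k` eigenvectors, by Markov's inequality for a high moment. -/
theorem IsClustering.card_lt_abs_le (hC : IsClustering G d k φ ε R C) (hd : 0 < d)
    (hG : G.IsRegularOfDegree d) (hφ : 0 < φ) (hε : 0 ≤ ε) (hmono : Monotone ev)
    (hu : ∀ j, Matrix.toEuclideanLin (normalizedLaplacian G d) (u j) = ev j • u j)
    {j : Fin (Fintype.card V)} (hj : (j : ℕ) < k) {m : ℝ} (hm : 0 < m)
    (hmC : ∀ i, m ≤ (C i).card) {r : ℕ} (hr : 4 * 2 ^ (r + 1) * ε ≤ φ ^ 2)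
    {B y : ℝ} (hB : 0 ≤ B) (hy : 0 < y) (hBy : B ^ 2 = 2 / m * y) :
    ((univ.filter fun x => B < |u j x|).card : ℝ) ≤ m / 2 / y ^ 2 ^ r := by
  have h1 := hC.sum_pow_two_pow_le hd hG hφ hε hmono hu hj hm hmC r hr
  have heven : Even (2 ^ (r + 1)) := ⟨2 ^ r, by ring⟩
  have h2 : ((univ.filter fun x => B < |u j x|).card : ℝ) * (2 / m * y) ^ 2 ^ r
      ≤ ∑ x, u j x ^ 2 ^ (r + 1) := by
    rw [← nsmul_eq_mul, ← sum_const]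
    refine (sum_le_sum fun x hx => ?_).trans (sum_le_sum_of_subset_of_nonneg (subset_univ _)
      fun x _ _ => heven.pow_nonneg _)
    rw [← hBy, ← pow_mul, ← pow_succ', ← heven.pow_abs (u j x)]
    exact pow_le_pow_left₀ hB (mem_filter.1 hx).2.le _
  rw [mul_pow] at h2
  have hM : 0 < (2 / m) ^ 2 ^ r := by positivity
  rw [le_div_iff₀ (by positivity), le_div_iff₀ (by norm_num)]
  have h3 := (mul_le_mul_of_nonneg_left h2 (by positivity : 0 ≤ 2 / m)).trans h1
  have h4 : (2 / m) ^ 2 ^ r *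
      (2 / m * (((univ.filter fun x => B < |u j x|).card : ℝ) * y ^ 2 ^ r))
      ≤ (2 / m) ^ 2 ^ r * 1 := by
    rw [mul_one]; refine le_trans (le_of_eq ?_) h3; ring
  have h5 := le_of_mul_le_mul_left h4 hM
  rw [div_mul_eq_mul_div, div_le_one hm] at h5
  linarith

end ClusteringSpectrum

/-! ### Concentration of empirical means -/

section Sampling

variable {V : Type*} [Fintype V] [DecidableEq V] [MeasurableSpace V] [MeasurableSingletonClass V]
  {Ω : Type*} [MeasurableSpace Ω] {P : Measure Ω} [IsProbabilityMeasure P] {C : Finset V}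

omit [IsProbabilityMeasure P] in
theorem measureReal_uniform {Y : Ω → V} (hY : Measurable Y)
    (hmap : P.map Y = uniformOn (C : Set V)) (p : V → Prop) [DecidablePred p] :
    P.real {ω | p (Y ω)} = ((C.filter p).card : ℝ) / C.card := by
  have h1 : {ω | p (Y ω)} = Y ⁻¹' ((univ.filter p : Finset V) : Set V) := by ext; simp
  rw [h1, Measure.real, ← Measure.map_apply hY (Finset.measurableSet _), hmap,
    uniformOn_apply_finset, ENNReal.toReal_div, ENNReal.toReal_natCast, ENNReal.toReal_natCast]
  congr 3
  ext; simp

theorem integral_uniform {Y : Ω → V} (hY : Measurable Y)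
    (hmap : P.map Y = uniformOn (C : Set V)) (v : V → ℝ) :
    ∫ ω, v (Y ω) ∂P = (∑ x ∈ C, v x) / C.card := by
  have : IsProbabilityMeasure (P.map Y) := Measure.isProbabilityMeasure_map hY.aemeasurable
  rw [← integral_map hY.aemeasurable (measurable_of_finite v).aestronglyMeasurable,
    integral_fintype Integrable.of_finite, sum_div, ← sum_subset (subset_univ C) fun x _ hx => ?_]
  · refine sum_congr rfl fun x hx => ?_
    rw [Measure.real, Measure.map_apply hY (measurableSet_singleton x)]
    have := measureReal_uniform hY hmap (fun z => z = x)
    rw [filter_eq', if_pos hx, card_singleton] at this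
    change P.real {ω | Y ω = x} • v x = _
    rw [this, smul_eq_mul]; push_cast; ring
  · rw [Measure.real, Measure.map_apply hY (measurableSet_singleton x)]
    have := measureReal_uniform hY hmap (fun z => z = x)
    rw [filter_eq', if_neg hx, card_empty] at this
    change P.real {ω | Y ω = x} • v x = _
    rw [this]; simp

/-- One-sided Hoeffding inequality for a bounded function of the sample. -/
theorem measureReal_le_average_sub {s : ℕ} (hs : 0 < s) {X : Fin s → Ω → V}
    (hX : ∀ j, Measurable (X j)) (hind : iIndepFun X P)
    (hmap : ∀ j, P.map (X j) = uniformOn (C : Set V)) {v : V → ℝ} {B : ℝ} (hB : 0 < B)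
    (hv : ∀ x, |v x| ≤ B) {t : ℝ} (ht : 0 ≤ t) :
    P.real {ω | t ≤ (s : ℝ)⁻¹ * ∑ j, v (X j ω) - (∑ x ∈ C, v x) / C.card}
      ≤ Real.exp (-(s * t ^ 2 / (2 * B ^ 2))) := by
  have hs' : (0 : ℝ) < s := by positivity
  have hsub : ∀ j ∈ (univ : Finset (Fin s)),
      HasSubgaussianMGF (fun ω => v (X j ω) - (∑ x ∈ C, v x) / C.card)
        ((‖B - -B‖₊ / 2) ^ 2) P := fun j _ => by
    have := hasSubgaussianMGF_of_mem_Icc (μ := P) (X := fun ω => v (X j ω)) (a := -B) (b := B)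
      ((measurable_of_finite v).comp (hX j)).aemeasurable
      (Filter.Eventually.of_forall fun ω => abs_le.1 (hv _))
    rwa [integral_uniform (hX j) (hmap j)] at this
  have hind' : iIndepFun (fun j ω => v (X j ω) - (∑ x ∈ C, v x) / C.card) P :=
    hind.comp (fun _ x => v x - (∑ x ∈ C, v x) / C.card) fun _ => measurable_of_finite _
  have h := HasSubgaussianMGF.measure_sum_ge_le_of_iIndepFun hind' hsub
    (ε := s * t) (by positivity)
  have hset : {ω | t ≤ (s : ℝ)⁻¹ * ∑ j, v (X j ω) - (∑ x ∈ C, v x) / C.card}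
      = {ω | s * t ≤ ∑ j, (v (X j ω) - (∑ x ∈ C, v x) / C.card)} := by
    ext ω
    simp only [Set.mem_ofPred_eq, sum_sub_distrib, sum_const, card_univ, Fintype.card_fin,
      nsmul_eq_mul]
    rw [← mul_le_mul_iff_right₀ hs', mul_sub, mul_inv_cancel_left₀ hs'.ne']
  rw [hset]
  refine h.trans_eq ?_
  congr 1
  have hc : ((∑ _j : Fin s, (‖B - -B‖₊ / 2) ^ 2 : NNReal) : ℝ) = s * B ^ 2 := by
    have : |B + B| = B + B := abs_of_pos (by linarith)
    simp [this]
  rw [hc]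
  field_simp

theorem measureReal_le_abs_average_sub {s : ℕ} (hs : 0 < s) {X : Fin s → Ω → V}
    (hX : ∀ j, Measurable (X j)) (hind : iIndepFun X P)
    (hmap : ∀ j, P.map (X j) = uniformOn (C : Set V)) {v : V → ℝ} {B : ℝ} (hB : 0 < B)
    (hv : ∀ x, |v x| ≤ B) {t : ℝ} (ht : 0 ≤ t) :
    P.real {ω | t ≤ |(s : ℝ)⁻¹ * ∑ j, v (X j ω) - (∑ x ∈ C, v x) / C.card|}
      ≤ 2 * Real.exp (-(s * t ^ 2 / (2 * B ^ 2))) := by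
  have h1 := measureReal_le_average_sub hs hX hind hmap hB hv ht
  have h2 := measureReal_le_average_sub hs hX hind hmap (v := fun x => -v x) hB
    (fun x => by rw [abs_neg]; exact hv x) ht
  rw [two_mul]
  refine le_trans ?_ (add_le_add h1 h2)
  refine (measureReal_mono fun ω hω => ?_).trans (measureReal_union_le _ _)
  rcases le_abs.1 (Set.mem_ofPred_eq ▸ hω) with h | h
  · exact Or.inl h
  · refine Or.inr (h.trans_eq ?_)
    simp only [sum_neg_distrib]; ring

/-- Concentration of the empirical mean of a vector-valued sample with heavy tails.  Every
coordinate is truncated at level `B`: with high probability the truncation is not noticed by the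
sample, Hoeffding's inequality applies to the truncated coordinate, and the Cauchy–Schwarz
inequality bounds the change of its mean. -/
theorem le_measureReal_norm_clusterMean_sub_le {k s : ℕ} (hs : 0 < s) (hC : C.Nonempty)
    {f : V → EuclideanSpace ℝ (Fin k)} {X : Fin s → Ω → V}
    (hX : ∀ j, Measurable (X j)) (hind : iIndepFun X P)
    (hmap : ∀ j, P.map (X j) = uniformOn (C : Set V)) {B p τ a : ℝ} (hB : 0 < B) (hτ : 0 ≤ τ)
    (htail : ∀ l, ((C.filter fun x => B < |f x l|).card : ℝ) ≤ p * C.card)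
    (hsq : ∀ l, ∑ x ∈ C, f x l ^ 2 ≤ 1) (hbias : p / C.card ≤ (τ / 2) ^ 2)
    (ha : 0 ≤ a) (haτ : k * τ ^ 2 ≤ a ^ 2) :
    1 - (s * k * p + 2 * k * Real.exp (-(s * (τ / 2) ^ 2 / (2 * B ^ 2))))
      ≤ P.real {ω | ‖clusterMean f C - empiricalMean f (fun j => X j ω)‖ ≤ a} := by
  have hn : (0 : ℝ) < C.card := by exact_mod_cast hC.card_pos
  let v : Fin k → V → ℝ := fun l x => if B < |f x l| then 0 else f x l
  have hv : ∀ l x, |v l x| ≤ B := fun l x => by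
    by_cases h : B < |f x l|
    · simpa [v, h] using hB.le
    · simpa [v, h] using not_lt.1 h
  let bad₁ : Set Ω := ⋃ j : Fin s, ⋃ l : Fin k, {ω | B < |f (X j ω) l|}
  let bad₂ : Set Ω := ⋃ l : Fin k,
    {ω | τ / 2 ≤ |(s : ℝ)⁻¹ * ∑ j, v l (X j ω) - (∑ x ∈ C, v l x) / C.card|}
  have hbad₁ : P.real bad₁ ≤ s * k * p := by
    calc P.real bad₁ ≤ ∑ j : Fin s, P.real (⋃ l : Fin k, {ω | B < |f (X j ω) l|}) :=
          measureReal_iUnion_fintype_le _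
      _ ≤ ∑ j : Fin s, ∑ l : Fin k, P.real {ω | B < |f (X j ω) l|} :=
          sum_le_sum fun j _ => measureReal_iUnion_fintype_le _
      _ ≤ ∑ j : Fin s, ∑ l : Fin k, p := sum_le_sum fun j _ => sum_le_sum fun l _ => by
          rw [measureReal_uniform (hX j) (hmap j) fun x => B < |f x l|, div_le_iff₀ hn]
          exact htail l
      _ = s * k * p := by simp [mul_assoc]
  have hbad₂ : P.real bad₂ ≤ 2 * k * Real.exp (-(s * (τ / 2) ^ 2 / (2 * B ^ 2))) := by
    calc P.real bad₂ ≤ ∑ l : Fin k, P.real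
          {ω | τ / 2 ≤ |(s : ℝ)⁻¹ * ∑ j, v l (X j ω) - (∑ x ∈ C, v l x) / C.card|} :=
          measureReal_iUnion_fintype_le _
      _ ≤ ∑ l : Fin k, 2 * Real.exp (-(s * (τ / 2) ^ 2 / (2 * B ^ 2))) :=
          sum_le_sum fun l _ =>
            measureReal_le_abs_average_sub hs hX hind hmap hB (hv l) (by positivity)
      _ = _ := by simp; ring
  have hmean : ∀ l, |(∑ x ∈ C, f x l) / C.card - (∑ x ∈ C, v l x) / C.card| ≤ τ / 2 := fun l => by
    refine abs_le_of_sq_le_sq ?_ (by positivity)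
    refine le_trans ?_ hbias
    have e1 : ∑ x ∈ C, f x l - ∑ x ∈ C, v l x = ∑ x ∈ C with B < |f x l|, f x l := by
      rw [← sum_sub_distrib, sum_filter]
      refine sum_congr rfl fun x _ => ?_
      by_cases h : B < |f x l| <;> simp [v, h]
    have e2 : (∑ x ∈ C with B < |f x l|, f x l) ^ 2 ≤ p * C.card := by
      refine sq_sum_le_card_mul_sum_sq.trans ?_
      have h1 : ∑ x ∈ C with B < |f x l|, f x l ^ 2 ≤ 1 :=
        (sum_le_sum_of_subset_of_nonneg (filter_subset _ _) fun _ _ _ => sq_nonneg _).trans (hsq l)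
      exact (mul_le_of_le_one_right (by positivity) h1).trans (htail l)
    rw [← sub_div, e1, div_pow, div_le_div_iff₀ (by positivity) hn]
    calc _ ≤ p * C.card * C.card := mul_le_mul_of_nonneg_right e2 hn.le
      _ = _ := by ring
  have hcover : (Set.univ : Set Ω)
      ⊆ {ω | ‖clusterMean f C - empiricalMean f (fun j => X j ω)‖ ≤ a} ∪ (bad₁ ∪ bad₂) := by
    intro ω _
    by_contra hω
    simp only [Set.mem_union, not_or] at hω
    obtain ⟨hgood, h1, h2⟩ := hω
    refine hgood ?_
    simp only [bad₁, bad₂, Set.mem_iUnion, Set.mem_ofPred_eq, not_exists] at h1 h2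
    refine (pow_le_pow_iff_left₀ (norm_nonneg _) ha two_ne_zero).1 ?_
    refine le_trans ?_ haτ
    rw [EuclideanSpace.norm_sq_eq]
    have hcoord : ∀ l : Fin k,
        ‖(clusterMean f C - empiricalMean f (fun j => X j ω)) l‖ ^ 2 ≤ τ ^ 2 := fun l => by
      refine pow_le_pow_left₀ (norm_nonneg _) ?_ 2
      have e1 : (clusterMean f C - empiricalMean f (fun j => X j ω)) l
          = ((∑ x ∈ C, f x l) / C.card - (∑ x ∈ C, v l x) / C.card)
            - ((s : ℝ)⁻¹ * ∑ j, v l (X j ω) - (∑ x ∈ C, v l x) / C.card) := by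
        have : ∀ j, v l (X j ω) = f (X j ω) l := fun j => if_neg (h1 j l)
        simp only [clusterMean, empiricalMean, PiLp.sub_apply, PiLp.smul_apply, WithLp.ofLp_sum,
          Finset.sum_apply, smul_eq_mul, this]
        ring
      rw [e1, Real.norm_eq_abs]
      refine (abs_sub _ _).trans ?_
      linarith [hmean l, not_le.1 (h2 l)]
    calc _ ≤ ∑ l : Fin k, τ ^ 2 := sum_le_sum fun l _ => hcoord l
      _ = k * τ ^ 2 := by simp
  have h3 := measureReal_mono (μ := P) hcover
  rw [probReal_univ] at h3
  have h4 := measureReal_union_le (μ := P)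
    {ω | ‖clusterMean f C - empiricalMean f (fun j => X j ω)‖ ≤ a} (bad₁ ∪ bad₂)
  have h5 := measureReal_union_le (μ := P) bad₁ bad₂
  linarith

end Sampling

/-! ### The sample size -/

/-- The order `2 ^ (r + 1)` of the moment used in the tail bound.  It must not exceed
`φ ^ 2 / (4 * ε)`, and it can be taken at least half as large, which makes `1 / 2 ^ r` at most the
exponent `80 * ε / φ ^ 2`.  For `ε = 0` there is no upper limit, and `r` is chosen in terms of `D`. -/
theorem exists_two_pow_le_rpow_le {φ ε D : ℝ} (hφ : 0 < φ) (hε : 0 ≤ ε) (hεφ : 8 * ε ≤ φ ^ 2)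
    (hD : 1 ≤ D) :
    ∃ r : ℕ, 4 * 2 ^ (r + 1) * ε ≤ φ ^ 2 ∧
      D ^ (1 / (2 : ℝ) ^ r) ≤ Real.exp 1 * D ^ (80 * ε / φ ^ 2) := by
  have hφ2 : 0 < φ ^ 2 := by positivity
  rcases hε.eq_or_lt with rfl | hpos
  · obtain ⟨r, hr⟩ := pow_unbounded_of_one_lt (Real.log D) one_lt_two
    refine ⟨r, by simpa using hφ2.le, ?_⟩
    rw [mul_zero, zero_div, Real.rpow_zero, mul_one, Real.rpow_def_of_pos (by linarith)]
    refine Real.exp_le_exp.2 ?_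
    rw [mul_one_div, div_le_one (by positivity)]
    exact hr.le
  · obtain ⟨r, hr1, hr2⟩ := exists_nat_pow_near (x := φ ^ 2 / (8 * ε)) (y := 2)
      ((one_le_div (by positivity)).2 hεφ) one_lt_two
    rw [le_div_iff₀ (by positivity)] at hr1
    rw [div_lt_iff₀ (by positivity), pow_succ 2 r] at hr2
    refine ⟨r, by rw [pow_succ]; linarith, ?_⟩
    have h1 : D ^ (1 / (2 : ℝ) ^ r) ≤ D ^ (80 * ε / φ ^ 2) := by
      refine Real.rpow_le_rpow_of_exponent_le hD ?_
      rw [div_le_div_iff₀ (by positivity) hφ2]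
      nlinarith [mul_pos hpos (pow_pos (two_pos : (0 : ℝ) < 2) r)]
    have h2 : (1 : ℝ) ≤ Real.exp 1 := Real.one_le_exp zero_le_one
    exact h1.trans (le_mul_of_one_le_left (by positivity) h2)

/-- Solves the bound for the sample size for `s ^ (1 - a)`; as `1 - a ≥ 1 / 2`, squaring the
constant compensates for the exponent. -/
theorem mul_le_rpow_of_sq_mul_rpow_le {K Y s a : ℝ} (hK : 1 ≤ K) (hY : 0 ≤ Y)
    (ha : a ≤ 1 / 2) (h : K ^ 2 * Y ^ (1 / (1 - a)) ≤ s) :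
    K * Y ≤ s ^ (1 - a) := by
  have h1a : 0 < 1 - a := by linarith
  calc K * Y = (K ^ 2) ^ (1 / 2 : ℝ) * (Y ^ (1 / (1 - a))) ^ (1 - a) := by
        rw [← Real.rpow_mul hY, one_div_mul_cancel h1a.ne', Real.rpow_one, ← Real.sqrt_eq_rpow,
          Real.sqrt_sq (by linarith)]
    _ ≤ (K ^ 2) ^ (1 - a) * (Y ^ (1 / (1 - a))) ^ (1 - a) := by
        refine mul_le_mul_of_nonneg_right ?_ (by positivity)
        exact Real.rpow_le_rpow_of_exponent_le (one_le_pow₀ hK) (by linarith)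
    _ = (K ^ 2 * Y ^ (1 / (1 - a))) ^ (1 - a) :=
        (Real.mul_rpow (by positivity) (by positivity)).symm
    _ ≤ s ^ (1 - a) := Real.rpow_le_rpow (by positivity) h h1a.le

theorem log_four_mul_le {x : ℝ} (hx : 2 ≤ x) : Real.log (4 * x) ≤ 3 * Real.log x := by
  have h1 : Real.log 2 ≤ Real.log x := Real.log_le_log two_pos hx
  have h2 : Real.log (4 * x) = 2 * Real.log 2 + Real.log x := by
    rw [Real.log_mul (by norm_num) (by linarith), show (4 : ℝ) = 2 ^ 2 by norm_num, Real.log_pow]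
    norm_num
  linarith

/-- The polylogarithmic factor in the bound for the sample size is at least one. -/
theorem one_le_mul_log_mul_rpow {k δ a : ℝ} (hk : 2 ≤ k) (hδ : 0 < δ) (hδ1 : δ < 1)
    (ha : 0 ≤ a) : 1 ≤ k * Real.log (k / δ) * (1 / δ) ^ a := by
  have hkδ : 2 ≤ k / δ := by rw [le_div_iff₀ hδ]; nlinarith
  have h1 : Real.log 2 ≤ Real.log (k / δ) := Real.log_le_log two_pos hkδ
  have h2 := Real.log_two_gt_d9
  refine one_le_mul_of_one_le_of_one_le ?_ ?_
  · nlinarith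
  · exact Real.one_le_rpow (by rw [le_div_iff₀ hδ]; linarith) ha

theorem exp_one_mul_rpow_le {s k δ a : ℝ} (hs : 0 ≤ s) (hk : 0 < k) (hδ : 0 < δ)
    (ha : a * Real.log k ≤ 1) :
    Real.exp 1 * (s * k / δ) ^ a ≤ 9 * (s ^ a * (1 / δ) ^ a) := by
  have hka : k ^ a ≤ Real.exp 1 := by
    rw [Real.rpow_def_of_pos hk]
    exact Real.exp_le_exp.2 (by linarith)
  have he : Real.exp 1 * Real.exp 1 ≤ 9 := by
    nlinarith [Real.exp_one_lt_d9, Real.exp_pos 1]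
  rw [show s * k / δ = s * (1 / δ) * k by ring, Real.mul_rpow (by positivity) hk.le,
    Real.mul_rpow hs (by positivity)]
  have hpos : 0 ≤ s ^ a * (1 / δ) ^ a := by positivity
  calc Real.exp 1 * (s ^ a * (1 / δ) ^ a * k ^ a)
      ≤ Real.exp 1 * (s ^ a * (1 / δ) ^ a * Real.exp 1) := by gcongr
    _ = (Real.exp 1 * Real.exp 1) * (s ^ a * (1 / δ) ^ a) := by ring
    _ ≤ _ := mul_le_mul_of_nonneg_right he hpos

/-- The exponent in Hoeffding's inequality for coordinates truncated at `√(2 * y / m)` and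
deviations `√(ζ ^ 2 / (8 * k * N))`, where `N` is the size of the cluster and `m ≥ N / R` that of
the smallest one. -/
theorem three_mul_log_le_exponent {R k Λ δ ζ a s m N y : ℝ} (hR : 1 ≤ R) (hk : 0 < k) (hΛ : 0 ≤ Λ)
    (hδ : 0 < δ) (hζ : 0 < ζ) (hs : 0 < s) (hm : 0 < m) (hN : 0 < N) (hNR : N ≤ R * m)
    (hy : 0 < y) (hys : y ≤ 9 * (s ^ a * (1 / δ) ^ a))
    (hsize : 864 * R * (k * Λ * (1 / δ) ^ a * (1 / ζ) ^ 2) ≤ s ^ (1 - a)) :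
    3 * Λ ≤ s * (ζ ^ 2 / (2 * k * N) / 2 ^ 2) / (2 * (2 / m * y)) := by
  have e1 : s * (ζ ^ 2 / (2 * k * N) / 2 ^ 2) / (2 * (2 / m * y))
      = s * ζ ^ 2 * m / (32 * k * N * y) := by
    field_simp; norm_num
  rw [e1, le_div_iff₀ (by positivity)]
  have hsplit : s ^ (1 - a) * s ^ a = s := by
    rw [← Real.rpow_add hs, sub_add_cancel, Real.rpow_one]
  have hsa : 0 < s ^ a := by positivity
  have hδa : 0 < (1 / δ) ^ a := by positivity
  calc 3 * Λ * (32 * k * N * y)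
      ≤ 3 * Λ * (32 * k * (R * m) * (9 * (s ^ a * (1 / δ) ^ a))) := by gcongr
    _ = (864 * R * (k * Λ * (1 / δ) ^ a * (1 / ζ) ^ 2)) * (s ^ a * ζ ^ 2 * m) := by
        generalize (1 / δ) ^ a = z
        field_simp; ring
    _ ≤ s ^ (1 - a) * (s ^ a * ζ ^ 2 * m) := mul_le_mul_of_nonneg_right hsize (by positivity)
    _ = s ^ (1 - a) * s ^ a * ζ ^ 2 * m := by ring
    _ = s * ζ ^ 2 * m := by rw [hsplit]

end SpectralClustering

theorem mainTheorem11 :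
    ∃ c₀ : ℝ, 0 < c₀ ∧ ∀ R : ℝ, 1 ≤ R → ∃ c : ℝ, 0 < c ∧
      ∀ (V : Type*) [Fintype V] [DecidableEq V] [MeasurableSpace V] [MeasurableSingletonClass V]
        (G : SimpleGraph V) [DecidableRel G.Adj] (d k : ℕ) (φ ε ζ δ : ℝ)
        (C : Fin k → Finset V) (f : V → EuclideanSpace ℝ (Fin k)),
        0 < d → G.IsRegularOfDegree d → 2 ≤ k →
        0 < φ → φ < 1 → 0 ≤ ε → 0 < ζ → ζ < 1 → 0 < δ → δ < 1 →
        ε * Real.log (k : ℝ) / φ ^ 2 ≤ c₀ →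
        SpectralClustering.IsClustering G d k φ ε R C →
        SpectralClustering.IsSpectralEmbedding G d k f →
        ∀ (i : Fin k) (s : ℕ),
          c * ((k : ℝ) * Real.log ((k : ℝ) / δ) * (1 / δ) ^ (80 * ε / φ ^ 2) * (1 / ζ) ^ 2)
              ^ (1 / (1 - 80 * ε / φ ^ 2)) ≤ (s : ℝ) →
          ∀ (Ω : Type*) [MeasurableSpace Ω] (P : Measure Ω) [IsProbabilityMeasure P]
            (X : Fin s → Ω → V),
            (∀ j, Measurable (X j)) → iIndepFun X P →
            (∀ j, P.map (X j) = uniformOn ((C i : Finset V) : Set V)) →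
            1 - δ ≤ P.real {ω |
              ‖SpectralClustering.clusterMean f (C i)
                - SpectralClustering.empiricalMean f (fun j => X j ω)‖
                ≤ ζ * ‖SpectralClustering.clusterMean f (C i)‖} := by
  refine ⟨1 / 1000, by norm_num, fun R hR => ⟨(864 * R) ^ 2, by positivity, ?_⟩⟩
  intro V _ _ _ _ G _ d k φ ε ζ δ C f hd hG hk hφ _ hε hζ hζ1 hδ hδ1 hc₀ hC hf i s hs Ω _ P _ X hX
    hind hmap
  obtain ⟨hkV, u, ev, hmono, hu, hf⟩ := hf
  set a := 80 * ε / φ ^ 2 with ha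
  have hφ2 : 0 < φ ^ 2 := by positivity
  have hk2 : (2 : ℝ) ≤ k := by exact_mod_cast hk
  have hk0 : (0 : ℝ) < k := by linarith
  have hlog2 : 0.69 < Real.log 2 := by linarith [Real.log_two_gt_d9]
  have hlogk : 0.69 < Real.log k := hlog2.trans_le (Real.log_le_log two_pos hk2)
  have ha0 : 0 ≤ a := by positivity
  have halog : a * Real.log k ≤ 80 / 1000 := by
    have : a * Real.log k = 80 * (ε * Real.log k / φ ^ 2) := by rw [ha]; ring
    rw [this]; linarith
  have ha1 : a ≤ 1 / 8 := by nlinarith only [halog, hlogk, ha0]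
  have hεφ : ε / φ ^ 2 ≤ 1 / 640 := by
    have : a = 80 * (ε / φ ^ 2) := by rw [ha]; ring
    linarith
  have hεφ' : 640 * ε ≤ φ ^ 2 := by
    rw [div_le_iff₀ hφ2] at hεφ; linarith
  have hkδ : (2 : ℝ) ≤ k / δ := by rw [le_div_iff₀ hδ]; nlinarith only [hδ1, hk2]
  have hΛ0 : 0 < Real.log (k / δ) := Real.log_pos (by linarith)
  have hY1 := SpectralClustering.one_le_mul_log_mul_rpow hk2 hδ hδ1 ha0
  have hY0 : 0 < k * Real.log (k / δ) * (1 / δ) ^ a * (1 / ζ) ^ 2 := by positivity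
  have hKY := SpectralClustering.mul_le_rpow_of_sq_mul_rpow_le (by linarith : 1 ≤ 864 * R) hY0.le
    (by linarith) hs
  have hs0 : 0 < s := by
    have : (0 : ℝ) < s := lt_of_lt_of_le (by positivity) hs
    exact_mod_cast this
  have hs1 : (1 : ℝ) ≤ s := by exact_mod_cast hs0
  have hs4 : 4 * δ ≤ s * ζ ^ 2 := by
    have h1 : (s : ℝ) ^ (1 - a) ≤ s := Real.rpow_le_self_of_one_le hs1 (by linarith)
    have h3 : (1 / ζ) ^ 2 ≤ k * Real.log (k / δ) * (1 / δ) ^ a * (1 / ζ) ^ 2 :=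
      le_mul_of_one_le_left (by positivity) hY1
    have h5 : 0 < (1 / ζ) ^ 2 := by positivity
    have h6 : 4 * (1 / ζ) ^ 2 ≤ s := by nlinarith only [hKY, h1, h3, h5, hR]
    have h7 := mul_le_mul_of_nonneg_right h6 (sq_nonneg ζ)
    have h8 : 4 * (1 / ζ) ^ 2 * ζ ^ 2 = 4 := by field_simp
    linarith
  -- A coordinate of a sample point exceeds the truncation level `B = √(2 * y / m)` with probability
  -- at most `1 / (2 * D)`, so all `s * k` of them stay below it with probability `1 - δ / 2`.
  set D : ℝ := s * k / δ with hDdef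
  have hD1 : 1 ≤ D := by rw [hDdef, le_div_iff₀ hδ]; nlinarith only [hs1, hk2, hδ1]
  have hD0 : 0 < D := by linarith
  obtain ⟨r, hr, hyD⟩ := SpectralClustering.exists_two_pow_le_rpow_le hφ hε (by linarith) hD1
  rw [← ha] at hyD
  set y := D ^ (1 / (2 : ℝ) ^ r) with hy
  have hy0 : 0 < y := by positivity
  have hypow : y ^ 2 ^ r = D := by
    rw [hy, ← Real.rpow_natCast, ← Real.rpow_mul hD0.le]
    push_cast
    rw [one_div_mul_cancel (by positivity), Real.rpow_one]
  have hys : y ≤ 9 * (s ^ a * (1 / δ) ^ a) :=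
    hyD.trans (SpectralClustering.exp_one_mul_rpow_le (by positivity) hk0 hδ (by linarith))
  obtain ⟨i₀, -, hi₀⟩ := Finset.exists_min_image Finset.univ (fun i => (C i).card)
    ⟨i, Finset.mem_univ i⟩
  set m : ℝ := ((C i₀).card : ℝ) with hm
  set N : ℝ := ((C i).card : ℝ) with hN
  have hm0 : 0 < m := by rw [hm]; exact_mod_cast (hC.nonempty i₀).card_pos
  have hmC : ∀ l, m ≤ (C l).card := fun l => Nat.cast_le.2 (hi₀ l (Finset.mem_univ l))
  have hmN : m ≤ N := hmC i
  have hN0 : 0 < N := by linarith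
  have hNR : N ≤ R * m := by
    have := hC.balanced i i₀
    rwa [div_le_iff₀ hm0] at this
  set B := √(2 / m * y) with hBdef
  have hB2 : B ^ 2 = 2 / m * y := Real.sq_sqrt (by positivity)
  have hB0 : 0 < B := Real.sqrt_pos.2 (by positivity)
  -- The error allowed per coordinate; half of it is for the bias of the truncation.
  set τ := √(ζ ^ 2 / (2 * k * N)) with hτdef
  have hτ2 : τ ^ 2 = ζ ^ 2 / (2 * k * N) := Real.sq_sqrt (by positivity)
  have htail : ∀ l, (((C i).filter fun x => B < |f x l|).card : ℝ) ≤ 1 / (2 * D) * N := fun l => by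
    have h1 := hC.card_lt_abs_le hd hG hφ hε hmono hu (j := Fin.castLE hkV l) l.2 hm0 hmC hr hB0.le
      hy0 hB2
    rw [hypow] at h1
    have h2 : (((C i).filter fun x => B < |f x l|).card : ℝ)
        ≤ ((Finset.univ.filter fun x => B < |u (Fin.castLE hkV l) x|).card : ℝ) := by
      simp only [hf]
      exact_mod_cast Finset.card_le_card (Finset.filter_subset_filter _ (Finset.subset_univ _))
    refine h2.trans (h1.trans ?_)
    rw [div_div, one_div_mul_eq_div]
    exact div_le_div_of_nonneg_right hmN (by positivity)
  have hsq : ∀ l, ∑ x ∈ C i, f x l ^ 2 ≤ 1 := fun l => by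
    simp only [hf]
    rw [← SpectralClustering.sum_basis_sq (u := u) (Fin.castLE hkV l)]
    exact Finset.sum_le_univ_sum_of_nonneg fun _ => sq_nonneg _
  have hbias : 1 / (2 * D) / N ≤ (τ / 2) ^ 2 := by
    rw [div_pow, hτ2, hDdef]
    have e1 : 1 / (2 * (s * k / δ)) / N = δ / (2 * s * k * N) := by field_simp
    have e2 : ζ ^ 2 / (2 * k * N) / 2 ^ 2 = ζ ^ 2 / (8 * k * N) := by ring
    rw [e1, e2, div_le_div_iff₀ (by positivity) (by positivity)]
    nlinarith only [mul_le_mul_of_nonneg_right hs4 (mul_pos hk0 hN0).le]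
  have hmean := hC.le_norm_clusterMean_sq hd hG hφ hmono hu hkV hf i
  have hnorm : k * τ ^ 2 ≤ (ζ * ‖SpectralClustering.clusterMean f (C i)‖) ^ 2 := by
    have h1 : 1 / 2 / N ≤ ‖SpectralClustering.clusterMean f (C i)‖ ^ 2 := by
      refine le_trans (div_le_div_of_nonneg_right ?_ hN0.le) hmean
      have : 4 * ε / φ ^ 2 = 4 * (ε / φ ^ 2) := by ring
      linarith
    rw [mul_pow, hτ2]
    refine le_trans (le_of_eq ?_) (mul_le_mul_of_nonneg_left h1 (sq_nonneg ζ))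
    field_simp
  have key := SpectralClustering.le_measureReal_norm_clusterMean_sub_le hs0 (hC.nonempty i) hX hind
    hmap hB0 (Real.sqrt_nonneg _) htail hsq hbias (by positivity) hnorm
  refine le_trans ?_ key
  have hp1 : s * k * (1 / (2 * D)) = δ / 2 := by rw [hDdef]; field_simp
  have hexponent : Real.log (4 * (k / δ)) ≤ s * (τ / 2) ^ 2 / (2 * B ^ 2) := by
    refine (SpectralClustering.log_four_mul_le hkδ).trans ?_
    rw [div_pow, hτ2, hB2]
    exact SpectralClustering.three_mul_log_le_exponent hR hk0 hΛ0.le hδ hζ (by positivity) hm0 hN0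
      hNR hy0 hys hKY
  have hp2 : 2 * k * Real.exp (-(s * (τ / 2) ^ 2 / (2 * B ^ 2))) ≤ δ / 2 := by
    calc 2 * k * Real.exp (-(s * (τ / 2) ^ 2 / (2 * B ^ 2)))
        ≤ 2 * k * Real.exp (-Real.log (4 * (k / δ))) := by gcongr
      _ = δ / 2 := by
          rw [Real.exp_neg, Real.exp_log (by positivity)]; field_simp; norm_num
  linarith
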